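/- All Banach spaces are over $\mathbb F=\mathbb R$ or $\mathbb C$. A basis $\mathcal B=(x_j)_{j=1}^\infty$ of a Banach space $X$ means a Schauder basis that is semi-normalized, i.e. $0<\inf_j\|x_j\|\le\sup_j\|x_j\|<\infty$; $(x_j^*)_{j=1}^\infty$ are its coordinate functionals, and $S_A(f)=\sum_{j\in A}x_j^*(f)\,x_j$ (defined whenever $A\subseteq\mathbb N$ is finite or $f$ has finite support $\operatorname{supp}(f)=\{j: x_j^*(f)\neq 0\}$). For $m\in\mathbb N=\{1,2,\dots\}$ put $$L_m[\mathcal B]=\sup\Big\{\frac{\|S_A(f)\|}{\|f\|}: f\ne 0,\ \operatorname{supp}(f)\subseteq\{1,\dots,m\},\ A\subseteq\mathbb N\Big\},\qquad \varphi_m[\mathcal B]=\sup_{|A|\le m}\Big\|\sum_{j\in A}x_j\Big\| .$$ The basis $\mathcal B$ is almost greedy if there is a constant $C$ such that $\|f-S_F(f)\|\le C\|f-S_A(f)\|$ whenever $f\in X$, $|A|\le|F|<\infty$ and $|x_j^*(f)|\le|x_k^*(f)|$ for all $j\in\mathbb N\setminus F$ and $k\in F$. A subsymmetric sequence space is a Banach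 space $S\subseteq\mathbb F^{\mathbb N}$ whose unit vectors $(e_j)_{j=1}^\infty$ form a Schauder basis of $S$, with the coordinates of the sequences as coordinate functionals, such that for every $\sum_j a_je_j\in S$, all signs $\varepsilon_j=\pm1$ and every increasing $\phi\colon\mathbb N\to\mathbb N$ the series $\sum_j\varepsilon_ja_je_{\phi(j)}$ converges and $\|\sum_j\varepsilon_ja_je_{\phi(j)}\|=\|\sum_ja_je_j\|$. A Banach space has nontrivial type if it has Rademacher type $p$ for some $1<p\le2$. For $\alpha_m,\beta_m\ge0$, write $\alpha_m\gtrsim\beta_m$ if there is a constant $C>0$ with $\beta_m\le C\alpha_m$ for all $m\in\mathbb N$. **Theorem 4.1.** Let $X$ be a Banach space with a basis $\mathcal B$, and let $S$ be either $\ell_1$ or a subsymmetric sequence space with nontrivial type. Assume that $S$ is isomorphic to a complemented subspace of $X$, and that $L_m[\mathcal B]\gtrsim\delta(m)$ for some non-decreasing function $\delta\colon[0,\infty)\to[0,\infty)$ that is doubling, i.e. $\delta(2t)\le C\delta(t)$ for all $t\ge0$ and some constant $C\ge 0$. Then $X$ has an almost greedy basis $\mathcal B_\kappa$ whose fundamental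 function is equivalent to $(\|\sum_{j=1}^n e_j\|_S)_{n=1}^\infty$, i.e. $\varphi_n[\mathcal B_\kappa]\gtrsim\|\sum_{j=1}^n e_j\|_S\gtrsim\varphi_n[\mathcal B_\kappa]$, and such that $L_m[\mathcal B_\kappa]\gtrsim\delta(\log m)$. -/

import Mathlib

open scoped BigOperators ENNReal

noncomputable section

namespace Greedy

/-! Schauder bases are indexed by `ℕ = {0, 1, 2, …}`, so that `b j` is the vector `x_{j+1}` of
a basis `(x_j)_{j ≥ 1}`, and `GeneralSchauderBasis.proj b A` is the coordinate projection `S_A`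
for a finite set `A`. -/

section Bases

variable {𝕜 X : Type*} [RCLike 𝕜] [NormedAddCommGroup X] [NormedSpace 𝕜 X]

/-- `0 < inf_j ‖x_j‖ ≤ sup_j ‖x_j‖ < ∞`. -/
def IsSemiNormalized (b : SchauderBasis 𝕜 X) : Prop :=
  ∃ c C : ℝ, 0 < c ∧ ∀ j : ℕ, c ≤ ‖b j‖ ∧ ‖b j‖ ≤ C

/-- The quotients `‖S_A f‖ / ‖f‖`, where `f` is supported on the first `m` basis vectors.
For such `f` only the finitely many elements of `A` among the first `m` indices matter, so it is
enough to let `A` run over the finite sets. -/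
def condQuotients (b : SchauderBasis 𝕜 X) (m : ℕ) : Set ℝ :=
  {r | ∃ (A : Finset ℕ) (f : X), (∀ j : ℕ, m ≤ j → b.coord j f = 0) ∧
    r = ‖GeneralSchauderBasis.proj b A f‖ / ‖f‖}

/-- The conditionality constant `L_m` of a basis. -/
def condConst (b : SchauderBasis 𝕜 X) (m : ℕ) : ℝ :=
  sSup (condQuotients b m)

/-- The supremum that defines `L_m` is finite. -/
theorem bddAbove_condQuotients (b : SchauderBasis 𝕜 X) (m : ℕ) :
    BddAbove (condQuotients b m) := by
  refine ⟨∑ j ∈ Finset.range m, ‖b.coord j‖ * ‖b j‖, ?_⟩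
  rintro r ⟨A, f, hf, rfl⟩
  have hs : (0 : ℝ) ≤ ∑ j ∈ Finset.range m, ‖b.coord j‖ * ‖b j‖ :=
    Finset.sum_nonneg fun j _ => by positivity
  refine div_le_of_le_mul₀ (norm_nonneg _) hs ?_
  rw [GeneralSchauderBasis.proj_apply]
  calc ‖∑ i ∈ A, b.coord i f • b i‖ ≤ ∑ i ∈ A, ‖b.coord i f • b i‖ := norm_sum_le _ _
    _ ≤ ∑ i ∈ A ∪ Finset.range m, ‖b.coord i f • b i‖ :=
        Finset.sum_le_sum_of_subset_of_nonneg Finset.subset_union_left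
          fun _ _ _ => norm_nonneg _
    _ = ∑ i ∈ Finset.range m, ‖b.coord i f • b i‖ := by
        symm
        refine Finset.sum_subset Finset.subset_union_right fun i _ hi => ?_
        rw [hf i (by simpa using hi)]
        simp
    _ ≤ ∑ i ∈ Finset.range m, ‖b.coord i‖ * ‖b i‖ * ‖f‖ := by
        refine Finset.sum_le_sum fun i _ => ?_
        rw [norm_smul, mul_right_comm]
        exact mul_le_mul_of_nonneg_right ((b.coord i).le_opNorm f) (norm_nonneg _)
    _ = _ := by rw [Finset.sum_mul]

/-- A semi-normalized basis is almost greedy if, up to a constant, every greedy approximation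
`S_F f` is as good as every projection `S_A f` with `|A| ≤ |F| < ∞`. -/
def IsAlmostGreedy (b : SchauderBasis 𝕜 X) : Prop :=
  IsSemiNormalized b ∧
  ∃ C : ℝ, ∀ (f : X) (A F : Finset ℕ), A.card ≤ F.card →
    (∀ j : ℕ, j ∉ F → ∀ k ∈ F, ‖b.coord j f‖ ≤ ‖b.coord k f‖) →
    ‖f - GeneralSchauderBasis.proj b F f‖ ≤ C * ‖f - GeneralSchauderBasis.proj b A f‖

/-- The fundamental function `φ_m = sup_{|A| ≤ m} ‖∑_{j ∈ A} x_j‖`. -/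
def fundFun (b : SchauderBasis 𝕜 X) (m : ℕ) : ℝ :=
  sSup {r | ∃ A : Finset ℕ, A.card ≤ m ∧ r = ‖∑ j ∈ A, b j‖}

/-- The supremum that defines `φ_m` is finite for a semi-normalized basis. -/
theorem bddAbove_fundFun (b : SchauderBasis 𝕜 X) (hb : IsSemiNormalized b) (m : ℕ) :
    BddAbove {r | ∃ A : Finset ℕ, A.card ≤ m ∧ r = ‖∑ j ∈ A, b j‖} := by
  obtain ⟨c, C, hc, h⟩ := hb
  have hC : 0 ≤ C := (norm_nonneg _).trans (h 0).2
  refine ⟨m * C, ?_⟩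
  rintro r ⟨A, hA, rfl⟩
  calc ‖∑ j ∈ A, b j‖ ≤ ∑ j ∈ A, ‖b j‖ := norm_sum_le _ _
    _ ≤ ∑ _j ∈ A, C := Finset.sum_le_sum fun j _ => (h j).2
    _ = A.card * C := by simp
    _ ≤ m * C := by gcongr

/-- A basis is 1-subsymmetric if all the series `∑ ε_j a_j x_{φ(j)}`, for signs `ε_j` and an
increasing `φ`, converge and have the same norm as `∑ a_j x_j`. -/
def IsOneSubsymmetric (e : SchauderBasis 𝕜 X) : Prop :=
  ∀ (f : X) (ε : ℕ → 𝕜), (∀ j, ε j = 1 ∨ ε j = -1) → ∀ φ : ℕ → ℕ, StrictMono φ →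
    ∃ g : X, HasSum (fun j => (ε j * e.coord j f) • e (φ j)) g (SummationFilter.conditional ℕ) ∧
      ‖g‖ = ‖f‖

/-- The space with the basis `e` is `ℓ₁` and `e` is the unit-vector basis. -/
def IsEllOne (e : SchauderBasis 𝕜 X) : Prop :=
  ∃ T : X ≃ₗᵢ[𝕜] lp (fun _ : ℕ => 𝕜) 1, ∀ j : ℕ, T (e j) = lp.single 1 j (1 : 𝕜)

end Bases

/-- Rademacher type `p`: `(𝔼 ‖∑ ε_i x_i‖ ^ p) ^ (1/p) ≤ C (∑ ‖x_i‖ ^ p) ^ (1/p)` for all finite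
sequences `(x_i)`, where the expectation is over all choices of signs `ε_i = ±1`. -/
def HasType (E : Type*) [NormedAddCommGroup E] (p : ℝ) : Prop :=
  ∃ C : ℝ, ∀ (n : ℕ) (x : Fin n → E),
    ((2 ^ n : ℝ)⁻¹ * ∑ ε : Fin n → ℤˣ, ‖∑ i, (ε i : ℤ) • x i‖ ^ p) ^ (1 / p) ≤
      C * (∑ i, ‖x i‖ ^ p) ^ (1 / p)

/-- Nontrivial type: type `p` for some `1 < p ≤ 2`. -/
def HasNontrivialType (E : Type*) [NormedAddCommGroup E] : Prop :=
  ∃ p : ℝ, 1 < p ∧ p ≤ 2 ∧ HasType E p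

/-- `S` is isomorphic to a complemented subspace of `X`. -/
def IsIsoToComplemented (𝕜 S X : Type*) [RCLike 𝕜] [NormedAddCommGroup S] [NormedSpace 𝕜 S]
    [NormedAddCommGroup X] [NormedSpace 𝕜 X] : Prop :=
  ∃ (L : S →L[𝕜] X) (T : X →L[𝕜] S), T.comp L = ContinuousLinearMap.id 𝕜 S

/-- `α_m ≲ β_m` for `m = 1, 2, …`. -/
def Dominated (α β : ℕ → ℝ) : Prop :=
  ∃ C : ℝ, 0 < C ∧ ∀ m : ℕ, 1 ≤ m → α m ≤ C * β m

/-- A doubling function on `[0, ∞)`. -/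
def IsDoubling (δ : ℝ → ℝ) : Prop :=
  ∃ C : ℝ, 0 ≤ C ∧ ∀ t : ℝ, 0 ≤ t → δ (2 * t) ≤ C * δ t

end Greedy

end

/-!
The new basis is built by the method of Dilworth, Kalton and Kutzarova. Cut `ℕ` into consecutive
blocks `σ_n` of lengths `s = 2^n`, let `P` be the averaging projection of `S` with respect to these
blocks and `Q = 1 - P`, and give a finitely supported sequence `f` the norm
`max (‖Q f‖_S, ‖∑_n (Λ_s / s) (∑_{j ∈ σ_n} f_j) x_n‖_X)`, where `Λ_m = ‖e_0 + ⋯ + e_{m-1}‖`. The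
completion is `ker P × X`, and the unit vectors become the vectors `blockVec` of this product. They
form a basis (`blockBasis`) for the following reasons.

* On a union of whole blocks, the coordinate projections are those of `e` on `ker P` and of `B`
  on `X` (`sum_blocks_blockVec`). Hence conditionality is inherited: the first `r`
  vectors of `B` live on the first `2^r - 1` indices, so that `L_r[B] ≲ L_{2^r - 1}`
  (`exists_condConst_le`), which is where the logarithm comes from (`dominated_log`).
* A projection onto at most `2^n` indices in blocks from the `n`-th on is harmless
  (`norm_sum_far_le`). This controls the remainders of partial sums and gives convergence.

The basis is almost greedy with fundamental function equivalent to `Λ` since it satisfies the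
estimates in `GreedyBounds`. For coefficients of modulus at most `t` on `A`, the norm is at most a
multiple of `t Λ_{|A|}`: in the `X`-component this is the bound `∑_{j ∈ A} Λ_s / s ≲ Λ_{|A|}`
(`IsFinSubsymmetric.sum_wt_le`), which only needs that `Λ` at least doubles after a fixed number of
dyadic steps. This growth is evident for `ℓ₁`, and follows from nontrivial type
(`IsFinSubsymmetric.exists_two_mul_unitSum_le`). The matching lower bound holds because the
`X`-component affects the coefficients in the block `σ_n` only by a multiple of `1 / Λ_s`
(`blockBasis_lower`), and the two bounds give the boundedness of greedy projections by splitting at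
the block whose length is about the number of coefficients (`blockBasis_quasi`).

Finally, `ker P × X` is isomorphic to `X`. As `S` is complemented in `X`, it is enough that `S`
absorbs `ker P`, which is a decomposition argument: for block lengths that form a sequence
interleaved from `(2^n)` and from itself, the mean-zero space `V` is isomorphic to `ker P × V`, and
it is complemented in `S` (`IsFinSubsymmetric.nonempty_prod_ker_equiv`). Boundedness of averaging
projections comes from averaging the cyclic rotations within the blocks
(`IsFinSubsymmetric.norm_sum_mean_le`).
-/

noncomputable section

namespace Greedy

/-! ### Finite sums in subsymmetric bases -/

section FiniteSums

variable {𝕜 S : Type*} [RCLike 𝕜] [NormedAddCommGroup S] [NormedSpace 𝕜 S]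

/-- Subsymmetry tested on finite linear combinations: their norms change neither when the vectors
are moved by a map that increases on the support, nor when signs are put on the coefficients.
It is shared by the unit vectors of `ℓ₁` and by every 1-subsymmetric basis. -/
structure IsFinSubsymmetric (e : SchauderBasis 𝕜 S) : Prop where
  spread : ∀ (A : Finset ℕ) (c : ℕ → 𝕜) (ψ : ℕ → ℕ), StrictMonoOn ψ A →
    ‖∑ j ∈ A, c j • e (ψ j)‖ = ‖∑ j ∈ A, c j • e j‖
  sign : ∀ (A : Finset ℕ) (c ε : ℕ → 𝕜), (∀ j, ε j = 1 ∨ ε j = -1) →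
    ‖∑ j ∈ A, (ε j * c j) • e j‖ = ‖∑ j ∈ A, c j • e j‖

theorem coord_apply_basis {X : Type*} [NormedAddCommGroup X] [NormedSpace 𝕜 X]
    (b : SchauderBasis 𝕜 X) (i j : ℕ) : b.coord i (b j) = if i = j then 1 else 0 := by
  rw [b.ortho]
  simp [Pi.single_apply]

theorem coord_sum_smul {X : Type*} [NormedAddCommGroup X] [NormedSpace 𝕜 X]
    (b : SchauderBasis 𝕜 X) (A : Finset ℕ) (c : ℕ → 𝕜) (i : ℕ) :
    b.coord i (∑ j ∈ A, c j • b j) = if i ∈ A then c i else 0 := by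
  simp [map_sum, coord_apply_basis]

theorem exists_enumeration (A : Finset ℕ) :
    ∃ α : ℕ → ℕ, StrictMonoOn α (Finset.range A.card : Finset ℕ) ∧
      (Finset.range A.card).image α = A := by
  refine ⟨fun i => if h : i < A.card then A.orderEmbOfFin rfl ⟨i, h⟩ else 0, ?_, ?_⟩
  · intro i hi j hj hij
    have hi' : i < A.card := by simpa using hi
    have hj' : j < A.card := by simpa using hj
    simp only [hi', hj', dif_pos]
    exact (A.orderEmbOfFin rfl).strictMono hij
  · ext x
    simp only [Finset.mem_image, Finset.mem_range]
    constructor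
    · rintro ⟨i, hi, rfl⟩
      rw [dif_pos hi]
      exact A.orderEmbOfFin_mem rfl _
    · intro hx
      have : x ∈ Set.range (A.orderEmbOfFin rfl) := by
        rw [Finset.range_orderEmbOfFin]; exact hx
      obtain ⟨⟨i, hi⟩, rfl⟩ := this
      exact ⟨i, hi, by rw [dif_pos hi]⟩

theorem exists_strictMono_eqOn (α : ℕ → ℕ) (m : ℕ)
    (hα : StrictMonoOn α (Finset.range m : Finset ℕ)) :
    ∃ β : ℕ → ℕ, StrictMono β ∧ ∀ i < m, β i = α i := by
  refine ⟨fun i => if i < m then α i else (∑ k ∈ Finset.range m, α k) + i, ?_, ?_⟩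
  · intro i j hij
    dsimp only
    by_cases hj : j < m
    · have hi : i < m := hij.trans hj
      rw [if_pos hi, if_pos hj]
      exact hα (by simpa using hi) (by simpa using hj) hij
    · rw [if_neg hj]
      by_cases hi : i < m
      · rw [if_pos hi]
        have := Finset.single_le_sum (f := α) (fun k _ => Nat.zero_le _) (Finset.mem_range.2 hi)
        omega
      · rw [if_neg hi]
        omega
  · intro i hi
    simp [hi]

theorem IsOneSubsymmetric.norm_sum_eq {e : SchauderBasis 𝕜 S} (he : IsOneSubsymmetric e)
    (A : Finset ℕ) (c ε : ℕ → 𝕜) (hε : ∀ j, ε j = 1 ∨ ε j = -1) (φ : ℕ → ℕ) (hφ : StrictMono φ) :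
    ‖∑ j ∈ A, (ε j * c j) • e (φ j)‖ = ‖∑ j ∈ A, c j • e j‖ := by
  obtain ⟨g, hg, hn⟩ := he (∑ j ∈ A, c j • e j) ε hε φ hφ
  rw [← hn]
  congr 1
  have h2 : HasSum (fun j => (ε j * e.coord j (∑ j ∈ A, c j • e j)) • e (φ j))
      (∑ j ∈ A, (ε j * e.coord j (∑ j ∈ A, c j • e j)) • e (φ j))
      (SummationFilter.conditional ℕ) := by
    refine hasSum_sum_of_ne_finset_zero ?_
    intro j hj
    rw [coord_sum_smul, if_neg hj]
    simp
  rw [HasSum.unique hg h2]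
  refine Finset.sum_congr rfl fun j hj => ?_
  rw [coord_sum_smul, if_pos hj]

theorem IsOneSubsymmetric.isFinSubsymmetric {e : SchauderBasis 𝕜 S} (he : IsOneSubsymmetric e) :
    IsFinSubsymmetric e := by
  have key : ∀ (m : ℕ) (c : ℕ → 𝕜) (α : ℕ → ℕ), StrictMonoOn α (Finset.range m : Finset ℕ) →
      ‖∑ i ∈ Finset.range m, c i • e (α i)‖ = ‖∑ i ∈ Finset.range m, c i • e i‖ := by
    intro m c α hα
    obtain ⟨β, hβ, hβα⟩ := exists_strictMono_eqOn α m hα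
    rw [← he.norm_sum_eq (Finset.range m) c (fun _ => 1) (fun _ => Or.inl rfl) β hβ]
    congr 1
    refine Finset.sum_congr rfl fun i hi => ?_
    rw [hβα i (Finset.mem_range.1 hi), one_mul]
  refine ⟨fun A c ψ hψ => ?_, fun A c ε hε => ?_⟩
  · obtain ⟨α, hα, hA⟩ := exists_enumeration A
    have hmem : ∀ i ∈ Finset.range A.card, α i ∈ A := fun i hi => by
      have := Finset.mem_image_of_mem α hi
      rwa [hA] at this
    have hsum : ∀ F : ℕ → S, ∑ j ∈ A, F j = ∑ i ∈ Finset.range A.card, F (α i) := fun F => by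
      conv_lhs => rw [← hA]
      exact Finset.sum_image hα.injOn
    rw [hsum, hsum, key _ (fun i => c (α i)) α hα,
      key _ (fun i => c (α i)) (fun i => ψ (α i))]
    intro i hi j hj hij
    exact hψ (hmem i hi) (hmem j hj) (hα hi hj hij)
  · exact he.norm_sum_eq A c ε hε id strictMono_id

theorem IsEllOne.norm_sum_smul {e : SchauderBasis 𝕜 S} (he : IsEllOne e) (A : Finset ℕ)
    (c : ℕ → 𝕜) : ‖∑ j ∈ A, c j • e j‖ = ∑ j ∈ A, ‖c j‖ := by
  obtain ⟨T, hT⟩ := he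
  have h := lp.norm_sum_single (E := fun _ : ℕ => 𝕜) (p := 1) (by simp) c A
  simp only [ENNReal.toReal_one, Real.rpow_one] at h
  rw [← h, ← T.norm_map, map_sum]
  congr 1
  refine Finset.sum_congr rfl fun j _ => ?_
  rw [map_smul, hT, ← lp.single_smul]
  simp

theorem IsEllOne.isFinSubsymmetric {e : SchauderBasis 𝕜 S} (he : IsEllOne e) :
    IsFinSubsymmetric e := by
  refine ⟨fun A c ψ hψ => ?_, fun A c ε hε => ?_⟩
  · have hinv : ∀ j ∈ A, Function.invFunOn ψ A (ψ j) = j := fun j hj =>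
      hψ.injOn.leftInvOn_invFunOn hj
    have : ∑ j ∈ A, c j • e (ψ j) = ∑ i ∈ A.image ψ, c (Function.invFunOn ψ A i) • e i := by
      rw [Finset.sum_image hψ.injOn]
      refine Finset.sum_congr rfl fun j hj => ?_
      rw [hinv j hj]
    rw [this, he.norm_sum_smul, he.norm_sum_smul, Finset.sum_image hψ.injOn]
    refine Finset.sum_congr rfl fun j hj => ?_
    rw [hinv j hj]
  · rw [he.norm_sum_smul, he.norm_sum_smul]
    refine Finset.sum_congr rfl fun j _ => ?_
    rcases hε j with h | h <;> simp [h]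

/-- The fundamental function `Λ_m = ‖e_0 + ⋯ + e_{m-1}‖` of the unit vectors. -/
def unitSum (e : SchauderBasis 𝕜 S) (m : ℕ) : ℝ := ‖∑ j ∈ Finset.range m, e j‖

theorem unitSum_nonneg {e : SchauderBasis 𝕜 S} (m : ℕ) : 0 ≤ unitSum e m := norm_nonneg _

namespace IsFinSubsymmetric

variable {e : SchauderBasis 𝕜 S} (he : IsFinSubsymmetric e)
include he

theorem norm_sum_le_of_subset {A A' : Finset ℕ} (hA : A ⊆ A') (c : ℕ → 𝕜) :
    ‖∑ j ∈ A, c j • e j‖ ≤ ‖∑ j ∈ A', c j • e j‖ := by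
  classical
  set ε : ℕ → 𝕜 := fun j => if j ∈ A then 1 else -1 with hε
  have h1 := he.sign A' c ε (fun j => by by_cases h : j ∈ A <;> simp [hε, h])
  have h2 : (2 : 𝕜) • ∑ j ∈ A, c j • e j =
      ∑ j ∈ A', c j • e j + ∑ j ∈ A', (ε j * c j) • e j := by
    rw [← Finset.sum_add_distrib, Finset.smul_sum]
    rw [← Finset.sum_subset hA (f := fun j => c j • e j + (ε j * c j) • e j)]
    · refine Finset.sum_congr rfl fun j hj => ?_
      simp [hε, hj, two_smul]
    · intro j _ hj
      simp [hε, hj]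
  have h3 : ‖(2 : 𝕜) • ∑ j ∈ A, c j • e j‖ ≤ 2 * ‖∑ j ∈ A', c j • e j‖ := by
    rw [h2]
    refine (norm_add_le _ _).trans ?_
    rw [h1]; linarith
  rw [norm_smul, RCLike.norm_ofNat] at h3
  linarith

omit he in
/-- The norm of `x + ∑ d_j w_j` is a convex function of `d ∈ [-1, 1]^A`, so it is maximal at
some choice of signs. -/
theorem norm_add_sum_smul_le (A : Finset ℕ) (w : ℕ → S) (M : ℝ) (d : ℕ → ℝ) (hd : ∀ j, |d j| ≤ 1)
    (x : S) (h : ∀ ε : ℕ → 𝕜, (∀ j, ε j = 1 ∨ ε j = -1) → ‖x + ∑ j ∈ A, ε j • w j‖ ≤ M) :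
    ‖x + ∑ j ∈ A, (d j : 𝕜) • w j‖ ≤ M := by
  classical
  induction A using Finset.induction_on generalizing x with
  | empty => simpa using h (fun _ => 1) (fun _ => Or.inl rfl)
  | insert a A ha ih =>
    have hs : ∀ s : 𝕜, (s = 1 ∨ s = -1) →
        ‖(x + s • w a) + ∑ j ∈ A, (d j : 𝕜) • w j‖ ≤ M := by
      intro s hs
      refine ih _ fun ε hε => ?_
      have := h (Function.update ε a s) (fun j => by
        by_cases hj : j = a
        · subst hj; simpa using hs
        · simpa [hj] using hε j)
      rw [Finset.sum_insert ha] at this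
      rw [Finset.sum_congr rfl (g := fun j => ε j • w j)] at this
      · simpa [add_assoc] using this
      · intro j hj
        rw [Function.update_of_ne (by rintro rfl; exact ha hj)]
    have hp := hs 1 (Or.inl rfl)
    have hm := hs (-1) (Or.inr rfl)
    set y := ∑ j ∈ A, (d j : 𝕜) • w j
    have hda := abs_le.1 (hd a)
    have hdec : x + ∑ j ∈ insert a A, (d j : 𝕜) • w j =
        (((1 + d a) / 2 : ℝ) : 𝕜) • ((x + (1 : 𝕜) • w a) + y) +
        (((1 - d a) / 2 : ℝ) : 𝕜) • ((x + (-1 : 𝕜) • w a) + y) := by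
      rw [Finset.sum_insert ha]
      push_cast
      module
    rw [hdec]
    refine (norm_add_le _ _).trans ?_
    rw [norm_smul, norm_smul, RCLike.norm_ofReal, RCLike.norm_ofReal,
      abs_of_nonneg (by linarith), abs_of_nonneg (by linarith)]
    nlinarith

theorem norm_sum_real_mul_le (A : Finset ℕ) (c : ℕ → 𝕜) (d : ℕ → ℝ) (t : ℝ) (ht : 0 ≤ t)
    (hd : ∀ j ∈ A, |d j| ≤ t) :
    ‖∑ j ∈ A, ((d j : 𝕜) * c j) • e j‖ ≤ t * ‖∑ j ∈ A, c j • e j‖ := by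
  classical
  rcases ht.eq_or_lt with rfl | ht
  · rw [Finset.sum_eq_zero]
    · simp
    · intro j hj
      have := abs_nonpos_iff.1 (hd j hj)
      simp [this]
  have h := norm_add_sum_smul_le (𝕜 := 𝕜) A (fun j => c j • e j) (‖∑ j ∈ A, c j • e j‖)
    (fun j => if j ∈ A then d j / t else 0) (fun j => by
      by_cases hj : j ∈ A
      · rw [if_pos hj, abs_div, abs_of_pos ht, div_le_one ht]; exact hd j hj
      · simp [hj]) 0 (fun ε hε => by
      rw [zero_add, ← he.sign A c ε hε]
      simp only [smul_smul]; exact le_rfl)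
  have h2 : ∑ j ∈ A, ((d j : 𝕜) * c j) • e j = (t : 𝕜) • (0 + ∑ j ∈ A,
      ((if j ∈ A then d j / t else 0 : ℝ) : 𝕜) • c j • e j) := by
    rw [zero_add, Finset.smul_sum]
    refine Finset.sum_congr rfl fun j hj => ?_
    rw [if_pos hj, smul_smul, smul_smul, RCLike.ofReal_div]
    congr 1
    have : (t : 𝕜) ≠ 0 := by exact_mod_cast ht.ne'
    field_simp
  rw [h2, norm_smul, RCLike.norm_ofReal, abs_of_pos ht]
  gcongr

/-- Multiplication of the coefficients by scalars of modulus at most `t`; over `ℂ`, the real and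
the imaginary parts are treated separately, whence the factor `2`. -/
theorem norm_sum_mul_le (A : Finset ℕ) (c d : ℕ → 𝕜) (t : ℝ) (ht : 0 ≤ t)
    (hd : ∀ j ∈ A, ‖d j‖ ≤ t) :
    ‖∑ j ∈ A, (d j * c j) • e j‖ ≤ 2 * t * ‖∑ j ∈ A, c j • e j‖ := by
  have h1 := he.norm_sum_real_mul_le A c (fun j => RCLike.re (d j)) t ht
    (fun j hj => (RCLike.abs_re_le_norm _).trans (hd j hj))
  have h2 := he.norm_sum_real_mul_le A c (fun j => RCLike.im (d j)) t ht
    (fun j hj => (RCLike.abs_im_le_norm _).trans (hd j hj))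
  have h3 : ∑ j ∈ A, (d j * c j) • e j = ∑ j ∈ A, ((RCLike.re (d j) : 𝕜) * c j) • e j +
      (RCLike.I : 𝕜) • ∑ j ∈ A, ((RCLike.im (d j) : 𝕜) * c j) • e j := by
    rw [Finset.smul_sum, ← Finset.sum_add_distrib]
    refine Finset.sum_congr rfl fun j _ => ?_
    rw [smul_smul, ← add_smul]
    congr 1
    conv_lhs => rw [← RCLike.re_add_im (d j)]
    ring
  rw [h3]
  refine (norm_add_le _ _).trans ?_
  rw [norm_smul]
  have hI : ‖(RCLike.I : 𝕜)‖ ≤ 1 := by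
    rcases eq_or_ne (RCLike.I : 𝕜) 0 with h | h
    · simp [h]
    · rw [RCLike.norm_I_of_ne_zero h]
  have : ‖(RCLike.I : 𝕜)‖ * ‖∑ j ∈ A, ((RCLike.im (d j) : 𝕜) * c j) • e j‖ ≤
      1 * ‖∑ j ∈ A, ((RCLike.im (d j) : 𝕜) * c j) • e j‖ := by gcongr
  linarith

theorem norm_sum_basis (A : Finset ℕ) : ‖∑ j ∈ A, e j‖ = unitSum e A.card := by
  obtain ⟨α, hα, hA⟩ := exists_enumeration A
  have h := he.spread (Finset.range A.card) (fun _ => 1) α hα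
  simp only [one_smul] at h
  rw [unitSum, ← h]
  conv_lhs => rw [← hA]
  rw [Finset.sum_image hα.injOn]

theorem norm_sum_le (A : Finset ℕ) (c : ℕ → 𝕜) (t : ℝ) (ht : 0 ≤ t) (hc : ∀ j ∈ A, ‖c j‖ ≤ t) :
    ‖∑ j ∈ A, c j • e j‖ ≤ 2 * t * unitSum e A.card := by
  have h := he.norm_sum_mul_le A (fun _ => 1) c t ht hc
  simpa [he.norm_sum_basis] using h

theorem le_norm_sum (A : Finset ℕ) (c : ℕ → 𝕜) (t : ℝ) (ht : 0 ≤ t) (hc : ∀ j ∈ A, t ≤ ‖c j‖) :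
    t * unitSum e A.card ≤ 2 * ‖∑ j ∈ A, c j • e j‖ := by
  rcases ht.eq_or_lt with rfl | ht
  · rw [zero_mul]; positivity
  have h := he.norm_sum_mul_le A c (fun j => (c j)⁻¹) t⁻¹ (by positivity) (fun j hj => by
    rw [norm_inv]; exact inv_anti₀ ht (hc j hj))
  have h2 : ∑ j ∈ A, ((c j)⁻¹ * c j) • e j = ∑ j ∈ A, e j := by
    refine Finset.sum_congr rfl fun j hj => ?_
    have : c j ≠ 0 := norm_pos_iff.1 (ht.trans_le (hc j hj))
    rw [inv_mul_cancel₀ this, one_smul]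
  rw [h2, he.norm_sum_basis] at h
  calc t * unitSum e A.card ≤ t * (2 * t⁻¹ * ‖∑ j ∈ A, c j • e j‖) := by gcongr
    _ = _ := by field_simp

theorem unitSum_mono {m n : ℕ} (h : m ≤ n) : unitSum e m ≤ unitSum e n := by
  have := he.norm_sum_le_of_subset (Finset.range_subset_range.2 h) (fun _ => 1)
  simpa [unitSum] using this

theorem unitSum_add_le (m n : ℕ) : unitSum e (m + n) ≤ unitSum e m + unitSum e n := by
  have h := he.norm_sum_basis (Finset.Ico m (m + n))
  simp only [Nat.card_Ico, add_tsub_cancel_left] at h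
  rw [← h, unitSum, unitSum, ← Finset.sum_range_add_sum_Ico _ (Nat.le_add_right m n)]
  exact norm_add_le _ _

omit he in
theorem unitSum_one_pos : 0 < unitSum e 1 := by
  have : e 0 ≠ 0 := e.linearIndependent.ne_zero 0
  simpa [unitSum] using this

theorem unitSum_pos {m : ℕ} (hm : 1 ≤ m) : 0 < unitSum e m :=
  unitSum_one_pos.trans_le (he.unitSum_mono hm)

theorem norm_sum_coord_le (G : Finset ℕ) (h : S) : ‖∑ j ∈ G, e.coord j h • e j‖ ≤ ‖h‖ := by
  have ht := e.tendsto_proj h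
  refine ge_of_tendsto ht.norm ?_
  filter_upwards [Filter.eventually_ge_atTop (G.sup id + 1)] with n hn
  rw [SchauderBasis.proj_apply]
  refine he.norm_sum_le_of_subset (fun j hj => ?_) (fun j => e.coord j h)
  have : id j ≤ G.sup id := Finset.le_sup hj
  simp only [id] at this
  exact Finset.mem_range.2 (by omega)

end IsFinSubsymmetric

end FiniteSums

/-! ### Growth of the fundamental function -/

section Growth

variable {𝕜 S : Type*} [RCLike 𝕜] [NormedAddCommGroup S] [NormedSpace 𝕜 S]

theorem exists_nat_rpow_le (C p : ℝ) (hp : 1 < p) :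
    ∃ k : ℕ, 1 ≤ k ∧ 2 * C * (k : ℝ) ^ (1 / p) ≤ k := by
  have hq : 0 < 1 - 1 / p := by
    rw [sub_pos, div_lt_one (by linarith)]; exact hp
  have h := (tendsto_rpow_atTop hq).comp tendsto_natCast_atTop_atTop
  obtain ⟨k, hk, hk1⟩ := ((h.eventually_ge_atTop (2 * C)).and
    (Filter.eventually_ge_atTop 1)).exists
  refine ⟨k, hk1, ?_⟩
  have hk0 : (0 : ℝ) < k := by exact_mod_cast hk1
  calc 2 * C * (k : ℝ) ^ (1 / p) ≤ (k : ℝ) ^ (1 - 1 / p) * (k : ℝ) ^ (1 / p) := by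
        gcongr
        exact hk
    _ = k := by rw [← Real.rpow_add hk0]; simp

/-- Nontrivial type forces the fundamental function to grow like a power. Otherwise consecutive
blocks of `2^n` unit vectors would span copies of `ℓ_∞^N` for `N = 2^k`, and the sign vectors
`y_i` given by the `k` binary digits of the block number would behave in them like the unit vectors
of `ℓ_1^k`, against type `p > 1`. -/
theorem IsFinSubsymmetric.exists_two_mul_unitSum_le {e : SchauderBasis 𝕜 S}
    (he : IsFinSubsymmetric e) (ht : HasNontrivialType S) :
    ∃ r : ℕ, ∀ n : ℕ, 2 * unitSum e (2 ^ n) ≤ unitSum e (2 ^ (n + r)) := by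
  obtain ⟨p, hp1, -, C, hC⟩ := ht
  obtain ⟨k, hk1, hk⟩ := exists_nat_rpow_le C p hp1
  refine ⟨k, fun n => ?_⟩
  have hp0 : 0 < p := by linarith
  set s : Bool → 𝕜 := fun b => if b then 1 else -1 with hs
  set y : Fin k → S := fun i =>
    ∑ j ∈ Finset.range (2 ^ (n + k)), (s (j.testBit (i + n)) * 1) • e j with hy
  have hyn : ∀ i, ‖y i‖ = unitSum e (2 ^ (n + k)) := fun i => by
    rw [hy]
    dsimp only
    rw [he.sign _ (fun _ => 1) (fun j => s (j.testBit (i + n)))]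
    · simp [unitSum]
    · intro j
      cases j.testBit (i + n) <;> simp [hs]
  have hlow : ∀ ε : Fin k → ℤˣ, k * unitSum e (2 ^ n) ≤ ‖∑ i, (ε i : ℤ) • y i‖ := by
    intro ε
    -- the binary digits of `q` single out the block on which all `ε_i y_i` have coefficients `1`
    set q : ℕ := Nat.ofBits (fun i : Fin k => decide (ε i = 1)) with hq
    have hqlt : q < 2 ^ k := Nat.ofBits_lt_two_pow _
    have hsub : Finset.Ico (q * 2 ^ n) (q * 2 ^ n + 2 ^ n) ⊆ Finset.range (2 ^ (n + k)) := by
      intro j hj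
      rw [Finset.mem_Ico] at hj
      rw [Finset.mem_range, pow_add, mul_comm]
      calc j < q * 2 ^ n + 2 ^ n := hj.2
        _ = (q + 1) * 2 ^ n := by ring
        _ ≤ 2 ^ k * 2 ^ n := Nat.mul_le_mul_right _ hqlt
    have hexp : ∑ i, (ε i : ℤ) • y i = ∑ j ∈ Finset.range (2 ^ (n + k)),
        (∑ i : Fin k, ((ε i : ℤ) : 𝕜) * s (j.testBit (i + n))) • e j := by
      simp only [hy, Finset.smul_sum, mul_one]
      rw [Finset.sum_comm]
      refine Finset.sum_congr rfl fun j _ => ?_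
      rw [Finset.sum_smul]
      refine Finset.sum_congr rfl fun i _ => ?_
      rw [mul_smul, Int.cast_smul_eq_zsmul]
    rw [hexp]
    refine le_trans ?_ (he.norm_sum_le_of_subset hsub _)
    have hcoef : ∀ j ∈ Finset.Ico (q * 2 ^ n) (q * 2 ^ n + 2 ^ n),
        (∑ i : Fin k, ((ε i : ℤ) : 𝕜) * s (j.testBit (i + n))) • e j = (k : 𝕜) • e j := by
      intro j hj
      rw [Finset.mem_Ico] at hj
      congr 1
      have hdiv : j / 2 ^ n = q := by
        refine Nat.div_eq_of_lt_le hj.1 ?_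
        calc j < _ := hj.2
          _ = _ := by ring
      rw [Finset.sum_congr rfl (g := fun _ => (1 : 𝕜))]
      · simp
      · intro i _
        rw [← Nat.testBit_div_two_pow, hdiv, hq, Nat.testBit_ofBits_lt _ _ i.2]
        rcases Int.units_eq_one_or (ε i) with h | h <;> simp [h, hs]
    rw [Finset.sum_congr rfl hcoef, ← Finset.smul_sum, norm_smul, he.norm_sum_basis]
    simp
  have h := hC k y
  have hl0 : 0 ≤ unitSum e (2 ^ n) := unitSum_nonneg _
  have hl1 : 0 ≤ unitSum e (2 ^ (n + k)) := unitSum_nonneg _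
  have hk0 : (0 : ℝ) < k := by exact_mod_cast hk1
  have hleft : k * unitSum e (2 ^ n) ≤
      ((2 ^ k : ℝ)⁻¹ * ∑ ε : Fin k → ℤˣ, ‖∑ i, (ε i : ℤ) • y i‖ ^ p) ^ (1 / p) := by
    have h1 : (k * unitSum e (2 ^ n)) ^ p ≤
        (2 ^ k : ℝ)⁻¹ * ∑ ε : Fin k → ℤˣ, ‖∑ i, (ε i : ℤ) • y i‖ ^ p := by
      rw [inv_mul_eq_div, le_div_iff₀ (by positivity)]
      have : ∑ _ε : Fin k → ℤˣ, (k * unitSum e (2 ^ n)) ^ p =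
          (k * unitSum e (2 ^ n)) ^ p * 2 ^ k := by
        simp [Fintype.card_units_int, mul_comm]
      rw [← this]
      refine Finset.sum_le_sum fun ε _ => ?_
      exact Real.rpow_le_rpow (by positivity) (hlow ε) hp0.le
    calc k * unitSum e (2 ^ n) = ((k * unitSum e (2 ^ n)) ^ p) ^ (1 / p) := by
          rw [one_div, Real.rpow_rpow_inv (by positivity) hp0.ne']
      _ ≤ _ := Real.rpow_le_rpow (by positivity) h1 (by positivity)
  have hright : C * (∑ i, ‖y i‖ ^ p) ^ (1 / p) =
      C * (k : ℝ) ^ (1 / p) * unitSum e (2 ^ (n + k)) := by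
    simp only [hyn, Finset.sum_const, Finset.card_univ, Fintype.card_fin, nsmul_eq_mul]
    rw [Real.mul_rpow hk0.le (by positivity), one_div, Real.rpow_rpow_inv hl1 hp0.ne']
    ring
  rw [hright] at h
  have h2 := hleft.trans h
  have h3 := mul_le_mul_of_nonneg_right hk hl1
  refine le_of_mul_le_mul_left ?_ hk0
  linarith

theorem IsEllOne.exists_two_mul_unitSum_le {e : SchauderBasis 𝕜 S} (he : IsEllOne e) :
    ∃ r : ℕ, ∀ n : ℕ, 2 * unitSum e (2 ^ n) ≤ unitSum e (2 ^ (n + r)) := by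
  have h : ∀ m, unitSum e m = m := fun m => by
    have := he.norm_sum_smul (Finset.range m) (fun _ => 1)
    simpa [unitSum] using this
  refine ⟨1, fun n => ?_⟩
  rw [h, h]
  push_cast
  rw [pow_succ]
  linarith

theorem sum_range_le_of_two_mul_le (u : ℕ → ℝ) (hu0 : ∀ n, 0 ≤ u n) (hu : Monotone u) (r : ℕ)
    (hr : ∀ n, 2 * u n ≤ u (n + r)) (k : ℕ) :
    ∑ n ∈ Finset.range (k + 1), u n ≤ (2 * r + 1) * u k := by
  have hr0 : ∀ s, s ≤ r → ∀ k, ∑ n ∈ Finset.range (k + s), u n ≤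
      ∑ n ∈ Finset.range k, u n + s * u (k + s) := by
    intro s _ k
    rw [Finset.sum_range_add]
    gcongr
    calc ∑ x ∈ Finset.range s, u (k + x) ≤ ∑ _x ∈ Finset.range s, u (k + s) :=
          Finset.sum_le_sum fun x hx => hu (by have := Finset.mem_range.1 hx; omega)
      _ = _ := by simp
  induction k using Nat.strong_induction_on with
  | _ k ih =>
    rcases Nat.eq_zero_or_pos r with rfl | hrpos
    · have h0 : ∀ n, u n = 0 := fun n => by
        have := hr n
        have := hu0 n
        simp only [add_zero] at *
        linarith
      simp [h0]
    by_cases hk : k < r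
    · calc ∑ n ∈ Finset.range (k + 1), u n ≤ ∑ _n ∈ Finset.range (k + 1), u k :=
            Finset.sum_le_sum fun x hx => hu (by have := Finset.mem_range.1 hx; omega)
        _ = (k + 1 : ℝ) * u k := by simp
        _ ≤ _ := by
            have : (k : ℝ) ≤ r := by exact_mod_cast hk.le
            exact mul_le_mul_of_nonneg_right (by linarith) (hu0 k)
    · obtain ⟨l, rfl⟩ : ∃ l, k = l + r := ⟨k - r, by omega⟩
      have h1 := ih l (by omega)
      have h2 : ∑ n ∈ Finset.range (l + r + 1), u n ≤
          ∑ n ∈ Finset.range (l + 1), u n + r * u (l + r) := by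
        rw [show l + r + 1 = (l + 1) + r by ring, Finset.sum_range_add]
        gcongr
        calc ∑ x ∈ Finset.range r, u (l + 1 + x) ≤ ∑ _x ∈ Finset.range r, u (l + r) :=
              Finset.sum_le_sum fun x hx => hu (by have := Finset.mem_range.1 hx; omega)
          _ = _ := by simp
      have h3 := hr l
      have h4 : (2 * r + 1) * u l ≤ (r + 1 / 2 : ℝ) * u (l + r) := by
        have : (0 : ℝ) ≤ r := Nat.cast_nonneg _
        nlinarith
      have := hu0 (l + r)
      nlinarith

end Growth

/-! ### Dyadic blocks of indices -/

/-- The number of the dyadic block `[2^n - 1, 2^(n+1) - 1)` that contains `j`. -/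
def blk (j : ℕ) : ℕ := Nat.log 2 (j + 1)

/-- The `n`-th dyadic block of indices, of length `2^n`; these blocks partition `ℕ`. -/
def dyadicBlock (n : ℕ) : Finset ℕ := Finset.Ico (2 ^ n - 1) (2 ^ (n + 1) - 1)

theorem blk_eq_iff {j n : ℕ} : blk j = n ↔ 2 ^ n ≤ j + 1 ∧ j + 1 < 2 ^ (n + 1) := by
  rw [blk, Nat.log_eq_iff (Or.inr ⟨by norm_num, by omega⟩)]

theorem mem_dyadicBlock {j n : ℕ} : j ∈ dyadicBlock n ↔ blk j = n := by
  rw [blk_eq_iff, dyadicBlock, Finset.mem_Ico]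
  have := Nat.one_le_two_pow (n := n)
  have := Nat.one_le_two_pow (n := n + 1)
  omega

theorem card_dyadicBlock (n : ℕ) : (dyadicBlock n).card = 2 ^ n := by
  rw [dyadicBlock, Nat.card_Ico, pow_succ]
  have := Nat.one_le_two_pow (n := n)
  omega

theorem blk_lt_iff {j n : ℕ} : blk j < n ↔ j < 2 ^ n - 1 := by
  rw [blk, Nat.log_lt_iff_lt_pow (by norm_num) (by omega)]
  omega

theorem le_blk_iff {j n : ℕ} : n ≤ blk j ↔ 2 ^ n - 1 ≤ j := by
  rw [← not_lt, blk_lt_iff, not_lt]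

theorem blk_mono {i j : ℕ} (h : i ≤ j) : blk i ≤ blk j := Nat.log_mono_right (by omega)

theorem sum_range_two_pow {M : Type*} [AddCommMonoid M] (F : ℕ → M) (n : ℕ) :
    ∑ j ∈ Finset.range (2 ^ n - 1), F j =
      ∑ k ∈ Finset.range n, ∑ j ∈ dyadicBlock k, F j := by
  induction n with
  | zero => simp
  | succ n ih =>
    rw [Finset.sum_range_succ, ← ih, dyadicBlock, Finset.sum_range_add_sum_Ico]
    rw [pow_succ]; omega

section Weights

variable {𝕜 S : Type*} [RCLike 𝕜] [NormedAddCommGroup S] [NormedSpace 𝕜 S]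
  {e : SchauderBasis 𝕜 S} (he : IsFinSubsymmetric e)

/-- The factor `Λ_s / s` for the length `s = 2^n` of a dyadic block: the functional
`f ↦ (Λ_s / s) ∑_{j ∈ σ} f_j` and the vector `Λ_s⁻¹ ∑_{j ∈ σ} e_j` of the block `σ` form a
biorthogonal pair of bounded elements. -/
def wt (e : SchauderBasis 𝕜 S) (n : ℕ) : ℝ := unitSum e (2 ^ n) / 2 ^ n

theorem wt_nonneg (n : ℕ) : 0 ≤ wt e n := div_nonneg (norm_nonneg _) (by positivity)

include he

theorem IsFinSubsymmetric.wt_antitone : Antitone (wt e) := by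
  refine antitone_nat_of_succ_le fun n => ?_
  rw [wt, wt, div_le_div_iff₀ (by positivity) (by positivity)]
  have h := he.unitSum_add_le (2 ^ n) (2 ^ n)
  rw [← two_mul, ← pow_succ'] at h
  rw [pow_succ (2 : ℝ)]
  have : (0 : ℝ) < 2 ^ n := by positivity
  nlinarith

/-- The restricted `ℓ₁`-estimate that follows from the growth of the fundamental function. The
blocks shorter than `|A|` contribute at most the sum of all their `Λ`, the other blocks
at most `|A|` times the largest of their weights. -/
theorem IsFinSubsymmetric.sum_wt_le (r : ℕ)
    (hr : ∀ n : ℕ, 2 * unitSum e (2 ^ n) ≤ unitSum e (2 ^ (n + r))) (A : Finset ℕ) :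
    ∑ j ∈ A, wt e (blk j) ≤ (2 * r + 3) * unitSum e A.card := by
  classical
  rcases A.eq_empty_or_nonempty with rfl | hA
  · simp only [Finset.sum_empty]
    have : 0 ≤ unitSum e (∅ : Finset ℕ).card := unitSum_nonneg _
    positivity
  have hm : A.card ≠ 0 := hA.card_pos.ne'
  set k := Nat.log 2 A.card with hk
  have hk1 : 2 ^ k ≤ A.card := Nat.pow_log_le_self 2 hm
  have hk2 : A.card < 2 ^ (k + 1) := Nat.lt_pow_succ_log_self (by norm_num) _
  have hmono : Monotone (fun n => unitSum e (2 ^ n)) := fun a b hab =>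
    he.unitSum_mono (Nat.pow_le_pow_right (by norm_num) hab)
  rw [← Finset.sum_filter_add_sum_filter_not A (fun j => j < 2 ^ (k + 1) - 1)]
  have h1 : ∑ j ∈ A with j < 2 ^ (k + 1) - 1, wt e (blk j) ≤
      (2 * r + 1) * unitSum e (2 ^ k) := by
    calc _ ≤ ∑ j ∈ Finset.range (2 ^ (k + 1) - 1), wt e (blk j) := by
          refine Finset.sum_le_sum_of_subset_of_nonneg ?_ fun _ _ _ => wt_nonneg _
          intro j hj
          exact Finset.mem_range.2 (Finset.mem_filter.1 hj).2
      _ = ∑ n ∈ Finset.range (k + 1), unitSum e (2 ^ n) := by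
          rw [sum_range_two_pow]
          refine Finset.sum_congr rfl fun n _ => ?_
          rw [Finset.sum_congr rfl (g := fun _ => wt e n)
            (fun j hj => by rw [mem_dyadicBlock.1 hj])]
          rw [Finset.sum_const, card_dyadicBlock, nsmul_eq_mul, wt]
          push_cast
          field_simp
      _ ≤ _ := sum_range_le_of_two_mul_le _ (fun n => unitSum_nonneg _) hmono r hr k
  have h2 : ∑ j ∈ A with ¬ j < 2 ^ (k + 1) - 1, wt e (blk j) ≤ 2 * unitSum e (2 ^ k) := by
    calc _ ≤ ∑ j ∈ A with ¬ j < 2 ^ (k + 1) - 1, wt e k := by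
          refine Finset.sum_le_sum fun j hj => he.wt_antitone ?_
          have := le_blk_iff.2 (not_lt.1 (Finset.mem_filter.1 hj).2)
          omega
      _ ≤ A.card * wt e k := by
          rw [Finset.sum_const, nsmul_eq_mul]
          have := wt_nonneg (e := e) k
          gcongr
          exact Finset.filter_subset _ _
      _ ≤ (2 ^ (k + 1) : ℝ) * wt e k := by
          have := wt_nonneg (e := e) k
          gcongr
          exact_mod_cast hk2.le
      _ = _ := by rw [wt, pow_succ]; field_simp
  have h3 := he.unitSum_mono hk1
  have h4 : (0 : ℝ) ≤ r := Nat.cast_nonneg _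
  nlinarith

end Weights

/-! ### Operators given by their values on the unit vectors -/

section Operators

variable {𝕜 S : Type*} [RCLike 𝕜] [NormedAddCommGroup S] [NormedSpace 𝕜 S]

theorem denseRange_linearCombination (e : SchauderBasis 𝕜 S) :
    DenseRange (Finsupp.linearCombination 𝕜 e) := by
  intro x
  refine mem_closure_of_tendsto (SchauderBasis.tendsto_proj e x) (Filter.Eventually.of_forall ?_)
  intro n
  rw [SchauderBasis.proj_apply]
  have : ∑ i ∈ Finset.range n, e.coord i x • e i ∈
      LinearMap.range (Finsupp.linearCombination 𝕜 e) :=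
    Submodule.sum_mem _ fun i _ => Submodule.smul_mem _ _
      ⟨Finsupp.single i 1, by simp⟩
  exact this

theorem clm_ext {F : Type*} [NormedAddCommGroup F] [NormedSpace 𝕜 F] (e : SchauderBasis 𝕜 S)
    {f g : S →L[𝕜] F} (h : ∀ j, f (e j) = g (e j)) : f = g := by
  refine DFunLike.coe_injective
    ((denseRange_linearCombination e).equalizer f.continuous g.continuous ?_)
  ext a
  simp [Finsupp.linearCombination_apply, Finsupp.sum, map_sum, h]

/-- The operator with `e_j ↦ w_j`, which is meaningful once `∑ a_j e_j ↦ ∑ a_j w_j` is bounded on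
finite sums. -/
def opOf [CompleteSpace S] (e : SchauderBasis 𝕜 S) (w : ℕ → S) : S →L[𝕜] S :=
  (Finsupp.linearCombination 𝕜 w).extendOfNorm (Finsupp.linearCombination 𝕜 e)

variable [CompleteSpace S]

theorem opOf_basis (e : SchauderBasis 𝕜 S) (w : ℕ → S) (C : ℝ)
    (h : ∀ (A : Finset ℕ) (c : ℕ → 𝕜), ‖∑ j ∈ A, c j • w j‖ ≤ C * ‖∑ j ∈ A, c j • e j‖) (j : ℕ) :
    opOf e w (e j) = w j := by
  have := LinearMap.extendOfNorm_eq (f := Finsupp.linearCombination 𝕜 w)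
    (denseRange_linearCombination e)
    ⟨C, fun a => h a.support a⟩ (Finsupp.single j 1)
  simpa [opOf] using this

theorem norm_opOf_le (e : SchauderBasis 𝕜 S) (w : ℕ → S) (C : ℝ)
    (h : ∀ (A : Finset ℕ) (c : ℕ → 𝕜), ‖∑ j ∈ A, c j • w j‖ ≤ C * ‖∑ j ∈ A, c j • e j‖) (x : S) :
    ‖opOf e w x‖ ≤ C * ‖x‖ :=
  LinearMap.norm_extendOfNorm_apply_le (denseRange_linearCombination e) C
    (fun a => h a.support a) x

/-- The operator with `e_j ↦ e_{ψ j}` for `j ∈ D` and `e_j ↦ 0` otherwise, for `ψ` increasing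
on `D`. -/
def shiftOp (e : SchauderBasis 𝕜 S) (D : ℕ → Prop) [DecidablePred D] (ψ : ℕ → ℕ) : S →L[𝕜] S :=
  opOf e (fun j => if D j then e (ψ j) else 0)

variable {e : SchauderBasis 𝕜 S} (he : IsFinSubsymmetric e)
include he

theorem IsFinSubsymmetric.shiftOp_basis (D : ℕ → Prop) [DecidablePred D] (ψ : ℕ → ℕ)
    (hψ : ∀ i j, D i → D j → i < j → ψ i < ψ j) (j : ℕ) :
    shiftOp e D ψ (e j) = if D j then e (ψ j) else 0 := by
  refine opOf_basis e _ 1 (fun A c => ?_) j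
  have h1 : ∑ j ∈ A, c j • (if D j then e (ψ j) else 0) = ∑ j ∈ A with D j, c j • e (ψ j) := by
    rw [Finset.sum_filter]
    exact Finset.sum_congr rfl fun j _ => by split_ifs <;> simp
  rw [h1, he.spread, one_mul]
  · exact he.norm_sum_le_of_subset (Finset.filter_subset _ _) c
  · intro i hi j hj hij
    simp only [Finset.coe_filter, Set.mem_ofPred_eq] at hi hj
    exact hψ i j hi.2 hj.2 hij

end Operators

/-! ### Averaging over blocks -/

/-- The index at offset `o` in the `n`-th dyadic block. -/
def pos (n o : ℕ) : ℕ := 2 ^ n - 1 + o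

/-- The offset of `j` in its dyadic block. -/
def off (j : ℕ) : ℕ := j + 1 - 2 ^ blk j

theorem two_pow_blk_le (j : ℕ) : 2 ^ blk j ≤ j + 1 := (blk_eq_iff.1 rfl).1

theorem pos_blk_off (j : ℕ) : pos (blk j) (off j) = j := by
  have := two_pow_blk_le j
  have := Nat.one_le_two_pow (n := blk j)
  rw [pos, off]
  omega

theorem off_lt (j : ℕ) : off j < 2 ^ blk j := by
  have := (blk_eq_iff (j := j).1 rfl).2
  rw [pow_succ] at this
  rw [off]
  omega

theorem blk_pos {n o : ℕ} (h : o < 2 ^ n) : blk (pos n o) = n := by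
  rw [blk_eq_iff, pos, pow_succ]
  omega

theorem off_pos {n o : ℕ} (h : o < 2 ^ n) : off (pos n o) = o := by
  rw [off, blk_pos h, pos]
  omega

theorem pos_lt_pos {n n' o o' : ℕ} (h : n < n') (ho : o < 2 ^ n) : pos n o < pos n' o' := by
  have h1 : 2 ^ (n + 1) ≤ 2 ^ n' := Nat.pow_le_pow_right (by norm_num) h
  rw [pow_succ] at h1
  rw [pos, pos]
  omega

theorem pos_lt_pos_of_blk {D : ℕ → Prop} {f g : ℕ → ℕ}
    (hg : ∀ j, D j → g j < 2 ^ f j)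
    (hf : ∀ i j, D i → D j → blk i < blk j → f i < f j)
    (hfg : ∀ i j, D i → D j → blk i = blk j → off i < off j → f i = f j ∧ g i < g j)
    (i j : ℕ) (hi : D i) (hj : D j) (hij : i < j) : pos (f i) (g i) < pos (f j) (g j) := by
  rcases (blk_mono hij.le).lt_or_eq with h | h
  · exact pos_lt_pos (hf i j hi hj h) (hg i hi)
  · have ho : off i < off j := by
      have h1 := two_pow_blk_le i
      rw [off, off, ← h]
      omega
    obtain ⟨h1, h2⟩ := hfg i j hi hj h ho
    rw [h1, pos, pos]
    omega

section Averaging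

variable {𝕜 S : Type*} [RCLike 𝕜] [NormedAddCommGroup S] [NormedSpace 𝕜 S]

/-- The mean of the first `2^{k n}` unit vectors of the `n`-th dyadic block. -/
def mean (e : SchauderBasis 𝕜 S) (k : ℕ → ℕ) (n : ℕ) : S :=
  ((2 : 𝕜) ^ k n)⁻¹ • ∑ o ∈ Finset.range (2 ^ k n), e (pos n o)

theorem sum_range_mul_mod {M : Type*} [AddCommMonoid M] (F : ℕ → M) (s d o : ℕ) (hs : 0 < s) :
    ∑ i ∈ Finset.range (d * s), F ((o + i) % s) = d • ∑ i ∈ Finset.range s, F i := by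
  have hper : Function.Periodic (fun i => F (i % s)) s := fun i => by simp
  induction d with
  | zero => simp
  | succ d ih =>
    rw [Nat.succ_mul, Finset.sum_range_add, ih, succ_nsmul]
    congr 1
    rw [← Finset.sum_image (s := Finset.range s) (g := fun x => (o + (d * s + x)) % s)
      (f := fun i => F i)]
    · refine Finset.sum_congr ?_ fun _ _ => rfl
      refine Finset.eq_of_subset_of_card_le ?_ ?_
      · intro i hi
        obtain ⟨x, -, rfl⟩ := Finset.mem_image.1 hi
        exact Finset.mem_range.2 (Nat.mod_lt _ hs)
      · rw [Finset.card_image_of_injOn]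
        intro a ha b hb hab
        have h1 : (o + d * s + a) ≡ (o + d * s + b) [MOD s] := by
          simpa [Nat.ModEq, add_assoc] using hab
        have h2 := Nat.ModEq.add_left_cancel' _ h1
        have ha' : a < s := by simpa using ha
        have hb' : b < s := by simpa using hb
        rwa [Nat.ModEq, Nat.mod_eq_of_lt ha', Nat.mod_eq_of_lt hb'] at h2
    · intro a ha b hb hab
      have h1 : (o + d * s + a) ≡ (o + d * s + b) [MOD s] := by
        simpa [Nat.ModEq, add_assoc] using hab
      have h2 := Nat.ModEq.add_left_cancel' _ h1
      have ha' : a < s := by simpa using ha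
      have hb' : b < s := by simpa using hb
      rwa [Nat.ModEq, Nat.mod_eq_of_lt ha', Nat.mod_eq_of_lt hb'] at h2

variable {e : SchauderBasis 𝕜 S} (he : IsFinSubsymmetric e)

section
include he

/-- A simultaneous cyclic rotation of all blocks is made of two increasing maps, one on the indices
that do not wrap around and one on those that do. -/
theorem IsFinSubsymmetric.norm_sum_rotate_le (k : ℕ → ℕ) (hk : ∀ n, k n ≤ n) (i : ℕ)
    (A : Finset ℕ) (hA : ∀ j ∈ A, off j < 2 ^ k (blk j)) (c : ℕ → 𝕜) :
    ‖∑ j ∈ A, c j • e (pos (blk j) ((off j + i) % 2 ^ k (blk j)))‖ ≤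
      2 * ‖∑ j ∈ A, c j • e j‖ := by
  classical
  have hpow : ∀ n, 2 ^ k n ≤ 2 ^ n := fun n => Nat.pow_le_pow_right (by norm_num) (hk n)
  have hmod : ∀ n, i % 2 ^ k n < 2 ^ k n := fun n => Nat.mod_lt _ (by positivity)
  rw [← Finset.sum_filter_add_sum_filter_not A
    (fun j => off j + i % 2 ^ k (blk j) < 2 ^ k (blk j))]
  have key : ∀ (D : ℕ → Prop) [DecidablePred D] (g : ℕ → ℕ),
      (∀ j ∈ A, D j → (off j + i) % 2 ^ k (blk j) = g j ∧ g j < 2 ^ k (blk j)) →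
      (∀ a ∈ A, ∀ b ∈ A, D a → D b → blk a = blk b → off a < off b → g a < g b) →
      ‖∑ j ∈ A with D j, c j • e (pos (blk j) ((off j + i) % 2 ^ k (blk j)))‖ ≤
        ‖∑ j ∈ A, c j • e j‖ := by
    intro D _ g hg hlt
    rw [Finset.sum_congr rfl (g := fun j => c j • e (pos (blk j) (g j))), he.spread]
    · exact he.norm_sum_le_of_subset (Finset.filter_subset _ _) c
    · intro a ha b hb hab
      have ha' := Finset.mem_filter.1 ha
      have hb' := Finset.mem_filter.1 hb
      refine pos_lt_pos_of_blk (D := fun j => j ∈ A ∧ D j) (f := blk) (g := g) ?_ ?_ ?_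
        a b ha' hb' hab
      · exact fun j hj => (hg j hj.1 hj.2).2.trans_le (hpow _)
      · exact fun _ _ _ _ h => h
      · exact fun a b ha hb h h' => ⟨h, hlt a ha.1 b hb.1 ha.2 hb.2 h h'⟩
    · intro j hj
      have hj' := Finset.mem_filter.1 hj
      rw [(hg j hj'.1 hj'.2).1]
  have hadd : ∀ j, (off j + i) % 2 ^ k (blk j) =
      (off j + i % 2 ^ k (blk j)) % 2 ^ k (blk j) := fun j => by simp
  refine (norm_add_le _ _).trans ?_
  rw [two_mul]
  refine add_le_add ?_ ?_
  · refine key _ (fun j => off j + i % 2 ^ k (blk j)) ?_ ?_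
    · intro j _ hD
      exact ⟨by rw [hadd, Nat.mod_eq_of_lt hD], hD⟩
    · intro a _ b _ _ _ hab h
      rw [hab]
      omega
  · refine key _ (fun j => off j + i % 2 ^ k (blk j) - 2 ^ k (blk j)) ?_ ?_
    · intro j hj hD
      have h1 := hA j hj
      have h2 := hmod (blk j)
      refine ⟨?_, by omega⟩
      rw [hadd, Nat.mod_eq_sub_mod (not_lt.1 hD), Nat.mod_eq_of_lt (by omega)]
    · intro a _ b _ hDa _ hab h
      rw [hab] at hDa ⊢
      omega

/-- The averaging projection has norm at most `2`: on finite sums it is the mean of the cyclic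
rotations, taken over as many steps as the largest block involved is long. -/
theorem IsFinSubsymmetric.norm_sum_mean_le (k : ℕ → ℕ) (hk : ∀ n, k n ≤ n)
    (A : Finset ℕ) (c : ℕ → 𝕜) :
    ‖∑ j ∈ A, c j • (if off j < 2 ^ k (blk j) then mean e k (blk j) else 0)‖ ≤
      2 * ‖∑ j ∈ A, c j • e j‖ := by
  classical
  have h1 : ∑ j ∈ A, c j • (if off j < 2 ^ k (blk j) then mean e k (blk j) else 0) =
      ∑ j ∈ A with off j < 2 ^ k (blk j), c j • mean e k (blk j) := by
    rw [Finset.sum_filter]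
    exact Finset.sum_congr rfl fun j _ => by split_ifs <;> simp
  rw [h1]
  refine le_trans ?_ (mul_le_mul_of_nonneg_left
    (he.norm_sum_le_of_subset (Finset.filter_subset (fun j => off j < 2 ^ k (blk j)) A) c)
    zero_le_two)
  set A' := A.filter (fun j => off j < 2 ^ k (blk j)) with hA'
  set K := A'.sup (fun j => k (blk j)) with hK
  have hKj : ∀ j ∈ A', k (blk j) ≤ K := fun j hj =>
    Finset.le_sup (f := fun j => k (blk j)) hj
  have h2 : ∑ j ∈ A', c j • mean e k (blk j) = ((2 : 𝕜) ^ K)⁻¹ •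
      ∑ i ∈ Finset.range (2 ^ K), ∑ j ∈ A',
        c j • e (pos (blk j) ((off j + i) % 2 ^ k (blk j))) := by
    rw [Finset.sum_comm, Finset.smul_sum]
    refine Finset.sum_congr rfl fun j hj => ?_
    rw [← Finset.smul_sum]
    have hd : 2 ^ K = 2 ^ (K - k (blk j)) * 2 ^ k (blk j) := by
      rw [← pow_add, Nat.sub_add_cancel (hKj j hj)]
    have hd' : (2 : 𝕜) ^ K = 2 ^ (K - k (blk j)) * 2 ^ k (blk j) := by
      rw [← pow_add, Nat.sub_add_cancel (hKj j hj)]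
    rw [hd, sum_range_mul_mod (fun x => e (pos (blk j) x)) _ _ _ (by positivity), mean, hd',
      ← Nat.cast_smul_eq_nsmul 𝕜, smul_smul, smul_smul, smul_smul]
    congr 1
    push_cast
    field_simp
  rw [h2, norm_smul, norm_inv, norm_pow, RCLike.norm_ofNat, inv_mul_le_iff₀ (by positivity)]
  refine (_root_.norm_sum_le _ _).trans ?_
  refine (Finset.sum_le_sum fun i _ => he.norm_sum_rotate_le k hk i A'
    (fun j hj => (Finset.mem_filter.1 hj).2) c).trans ?_
  simp

end

variable [CompleteSpace S]

/-- The averaging projection onto the span of the `mean e k n`. -/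
def avgOp (e : SchauderBasis 𝕜 S) (k : ℕ → ℕ) : S →L[𝕜] S :=
  opOf e (fun j => if off j < 2 ^ k (blk j) then mean e k (blk j) else 0)

/-- The projection that averages to zero on the first `2^{k n}` indices of each block and kills all
other indices. -/
def meanZeroOp (e : SchauderBasis 𝕜 S) (k : ℕ → ℕ) : S →L[𝕜] S :=
  shiftOp e (fun j => off j < 2 ^ k (blk j)) (fun j => j) - avgOp e k

include he

theorem IsFinSubsymmetric.avgOp_basis (k : ℕ → ℕ) (hk : ∀ n, k n ≤ n) (j : ℕ) :
    avgOp e k (e j) = if off j < 2 ^ k (blk j) then mean e k (blk j) else 0 :=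
  opOf_basis e _ 2 (he.norm_sum_mean_le k hk) j

theorem IsFinSubsymmetric.norm_avgOp_le (k : ℕ → ℕ) (hk : ∀ n, k n ≤ n) (x : S) :
    ‖avgOp e k x‖ ≤ 2 * ‖x‖ :=
  norm_opOf_le e _ 2 (he.norm_sum_mean_le k hk) x

theorem IsFinSubsymmetric.meanZeroOp_basis (k : ℕ → ℕ) (hk : ∀ n, k n ≤ n) (j : ℕ) :
    meanZeroOp e k (e j) = if off j < 2 ^ k (blk j) then e j - mean e k (blk j) else 0 := by
  rw [meanZeroOp, sub_apply, he.avgOp_basis k hk, he.shiftOp_basis _ _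
    (fun i j _ _ h => h)]
  split_ifs <;> simp

theorem IsFinSubsymmetric.meanZeroOp_pos (k : ℕ → ℕ) (hk : ∀ n, k n ≤ n) {n o : ℕ}
    (ho : o < 2 ^ n) : meanZeroOp e k (e (pos n o)) =
      if o < 2 ^ k n then e (pos n o) - mean e k n else 0 := by
  rw [he.meanZeroOp_basis k hk, blk_pos ho, off_pos ho]

theorem IsFinSubsymmetric.avgOp_mean (k : ℕ → ℕ) (hk : ∀ n, k n ≤ n) (n : ℕ) :
    avgOp e k (mean e k n) = mean e k n := by
  conv_lhs => rw [mean]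
  rw [map_smul, map_sum, Finset.sum_congr rfl (g := fun _ => mean e k n)]
  · rw [Finset.sum_const, Finset.card_range, ← Nat.cast_smul_eq_nsmul 𝕜, smul_smul]
    push_cast
    rw [inv_mul_cancel₀ (pow_ne_zero _ two_ne_zero), one_smul]
  · intro o ho
    have ho1 := Finset.mem_range.1 ho
    have ho2 : o < 2 ^ n := ho1.trans_le (Nat.pow_le_pow_right (by norm_num) (hk n))
    rw [he.avgOp_basis k hk, blk_pos ho2, off_pos ho2, if_pos ho1]

theorem IsFinSubsymmetric.meanZeroOp_mean (k : ℕ → ℕ) (hk : ∀ n, k n ≤ n) (n : ℕ) :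
    meanZeroOp e k (mean e k n) = 0 := by
  rw [meanZeroOp, sub_apply, he.avgOp_mean k hk, sub_eq_zero]
  conv_lhs => rw [mean]
  rw [map_smul, map_sum, mean]
  congr 1
  refine Finset.sum_congr rfl fun o ho => ?_
  have ho1 := Finset.mem_range.1 ho
  have ho2 : o < 2 ^ n := ho1.trans_le (Nat.pow_le_pow_right (by norm_num) (hk n))
  rw [he.shiftOp_basis _ _ (fun i j _ _ h => h), blk_pos ho2, off_pos ho2, if_pos ho1]

theorem IsFinSubsymmetric.meanZeroOp_mul_self (k : ℕ → ℕ) (hk : ∀ n, k n ≤ n) :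
    meanZeroOp e k * meanZeroOp e k = meanZeroOp e k := by
  refine clm_ext e fun j => ?_
  rw [mul_apply_eq_comp, he.meanZeroOp_basis k hk]
  split_ifs with h
  · rw [map_sub, he.meanZeroOp_mean k hk, sub_zero, he.meanZeroOp_basis k hk, if_pos h]
  · simp

theorem IsFinSubsymmetric.avgOp_mul_meanZeroOp_id :
    avgOp e id * meanZeroOp e id = 0 := by
  refine clm_ext e fun j => ?_
  have hid : ∀ n, (id : ℕ → ℕ) n ≤ n := fun _ => le_rfl
  have hj : off j < 2 ^ (id (blk j)) := off_lt j
  rw [mul_apply_eq_comp, he.meanZeroOp_basis id hid, if_pos hj, map_sub,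
    he.avgOp_mean id hid, he.avgOp_basis id hid, if_pos hj]
  simp

theorem IsFinSubsymmetric.meanZeroOp_id : meanZeroOp e id = 1 - avgOp e id := by
  refine clm_ext e fun j => ?_
  have hid : ∀ n, (id : ℕ → ℕ) n ≤ n := fun _ => le_rfl
  have hj : off j < 2 ^ (id (blk j)) := off_lt j
  rw [he.meanZeroOp_basis id hid, if_pos hj, sub_apply,
    he.avgOp_basis id hid, if_pos hj]
  rfl

end Averaging

/-! ### The subsymmetric space absorbs the mean-zero part -/

/-- Exponents of the block lengths in a sequence which is the interleaving of the sequence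
`0, 1, 2, …` (at the even places) with itself (at the odd places). -/
def selfLen (n : ℕ) : ℕ :=
  if n % 2 = 0 then n / 2 else selfLen (n / 2)
termination_by n
decreasing_by omega

theorem selfLen_two_mul (n : ℕ) : selfLen (2 * n) = n := by
  rw [selfLen, if_pos (by omega)]
  omega

theorem selfLen_two_mul_add_one (n : ℕ) : selfLen (2 * n + 1) = selfLen n := by
  rw [selfLen, if_neg (by omega)]
  congr 1
  omega

theorem selfLen_le (n : ℕ) : selfLen n ≤ n := by
  induction n using Nat.strong_induction_on with
  | _ n ih =>
    rw [selfLen]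
    split_ifs with h
    · omega
    · exact (ih (n / 2) (by omega)).trans (Nat.div_le_self _ _)

section Absorb

variable {𝕜 S : Type*} [RCLike 𝕜] [NormedAddCommGroup S] [NormedSpace 𝕜 S]

/-- If the idempotent `q` is the sum of a copy `a q a'` of itself and of a copy `b p b'` of the
projection `p` onto `V`, then `V` can be absorbed: `S ≅ ker q ⊕ q(S) ≅ ker q ⊕ q(S) ⊕ V`. -/
theorem nonempty_prod_equiv_of_absorbing (V : Submodule 𝕜 S) (q p a a' b b' : S →L[𝕜] S)
    (hpV : ∀ f, p f ∈ V) (hVp : ∀ h ∈ V, p h = h) (hq : q * q = q)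
    (hdec : q = a * q * a' + b * p * b') (haa : a' * a = 1) (hbb : b' * b = 1)
    (hab : a' * b = 0) (hba : b' * a = 0) : Nonempty ((S × V) ≃L[𝕜] S) := by
  have hqa : q * a = a * q := by
    calc q * a = (a * q * a' + b * p * b') * a := by rw [← hdec]
      _ = a * q * (a' * a) + b * p * (b' * a) := by noncomm_ring
      _ = a * q := by rw [haa, hba]; simp
  have hqb : q * b = b * p := by
    calc q * b = (a * q * a' + b * p * b') * b := by rw [← hdec]
      _ = a * q * (a' * b) + b * p * (b' * b) := by noncomm_ring
      _ = b * p := by rw [hab, hbb]; simp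
  have haq : a' * q = q * a' := by
    calc a' * q = a' * (a * q * a' + b * p * b') := by rw [← hdec]
      _ = (a' * a) * q * a' + (a' * b) * p * b' := by noncomm_ring
      _ = q * a' := by rw [haa, hab]; simp
  have hbq : b' * q = p * b' := by
    calc b' * q = b' * (a * q * a' + b * p * b') := by rw [← hdec]
      _ = (b' * a) * q * a' + (b' * b) * p * b' := by noncomm_ring
      _ = p * b' := by rw [hba, hbb]; simp
  have app : ∀ {u v : S →L[𝕜] S}, u = v → ∀ x, u x = v x := fun h x => by rw [h]
  have hq' := app hq
  have hqa' := app hqa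
  have hqb' := app hqb
  have haq' := app haq
  have hbq' := app hbq
  have haa' := app haa
  have hbb' := app hbb
  have hab' := app hab
  have hba' := app hba
  have hdec' := app hdec
  simp only [mul_apply_eq_comp, one_apply_eq_self, zero_apply, add_apply]
    at hq' hqa' hqb' haq' hbq' haa' hbb' hab' hba' hdec'
  refine ⟨ContinuousLinearEquiv.equivOfInverse
    ((1 - q + a * q).comp (ContinuousLinearMap.fst 𝕜 S V) +
      b.comp (V.subtypeL.comp (ContinuousLinearMap.snd 𝕜 S V)))
    ((1 - q + q * a').prod ((p.codRestrict V hpV).comp b')) ?_ ?_⟩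
  · rintro ⟨f, h⟩
    have hh := hVp h h.2
    refine Prod.ext ?_ (Subtype.ext ?_)
    · simp [hq', hqa', hqb', haa', hab', hh, ← haq']
    · have h1 : b' (a (q f)) = 0 := hba' _
      have h2 : p (b' (q f)) = p (b' f) := by rw [← hbq', hq', hbq']
      simp [hbb', hh, h1, h2]
  · intro f
    have := hdec' f
    have h1 : q (q (a' f)) = q (a' f) := hq' _
    simp [h1, hq']
    rw [add_assoc, ← this, sub_add_cancel]

variable [CompleteSpace S] {e : SchauderBasis 𝕜 S} (he : IsFinSubsymmetric e)
include he

/-- `S` absorbs the sequences of `S` with mean zero on the dyadic blocks. In the mean-zero space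
for blocks of the lengths `2^(selfLen n)`, the even blocks are a copy of the one for dyadic blocks
and the odd blocks are a copy of the whole. -/
theorem IsFinSubsymmetric.nonempty_prod_ker_equiv :
    Nonempty ((S × LinearMap.ker (avgOp e id : S →ₗ[𝕜] S)) ≃L[𝕜] S) := by
  have hid : ∀ n, (id : ℕ → ℕ) n ≤ n := fun _ => le_rfl
  have hlt : ∀ {n m o : ℕ}, n ≤ m → o < 2 ^ n → o < 2 ^ m := fun h ho =>
    ho.trans_le (Nat.pow_le_pow_right (by norm_num) h)
  -- the maps `(n, o) ↦ (2n + r, o)` between blocks and their left inverses, for `r = 0, 1`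
  let up : ℕ → S →L[𝕜] S := fun r => shiftOp e (fun _ => True)
    (fun j => pos (2 * blk j + r) (off j))
  let down : ℕ → S →L[𝕜] S := fun r => shiftOp e
    (fun j => blk j % 2 = r ∧ off j < 2 ^ (blk j / 2)) (fun j => pos (blk j / 2) (off j))
  have hup : ∀ r n o, o < 2 ^ n → up r (e (pos n o)) = e (pos (2 * n + r) o) := by
    intro r n o ho
    rw [he.shiftOp_basis _ _ (pos_lt_pos_of_blk (f := fun j => 2 * blk j + r) (g := off) ?_ ?_ ?_),
      if_pos trivial, blk_pos ho, off_pos ho]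
    · exact fun j _ => hlt (by omega) (off_lt j)
    · intro i j _ _ h; omega
    · intro i j _ _ h h'; exact ⟨by rw [h], h'⟩
  have hdown : ∀ r n o, o < 2 ^ n → down r (e (pos n o)) =
      if n % 2 = r ∧ o < 2 ^ (n / 2) then e (pos (n / 2) o) else 0 := by
    intro r n o ho
    rw [he.shiftOp_basis _ _ (pos_lt_pos_of_blk (f := fun j => blk j / 2) (g := off) ?_ ?_ ?_),
      blk_pos ho, off_pos ho]
    · exact fun j hj => hj.2
    · intro i j hi hj h; omega
    · intro i j _ _ h h'; exact ⟨by rw [h], h'⟩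
  have hext : ∀ f g : S →L[𝕜] S, (∀ n o, o < 2 ^ n → f (e (pos n o)) = g (e (pos n o))) →
      f = g := fun f g h => clm_ext e fun j => by
    have := h (blk j) (off j) (off_lt j)
    rwa [pos_blk_off] at this
  have hupmean : ∀ (k k' : ℕ → ℕ) (r n : ℕ), k n ≤ n → k' (2 * n + r) = k n →
      up r (mean e k n) = mean e k' (2 * n + r) := by
    intro k k' r n hkn hkk
    rw [mean, mean, map_smul, map_sum, hkk]
    congr 1
    refine Finset.sum_congr rfl fun o ho => ?_
    rw [hup r n o (hlt hkn (Finset.mem_range.1 ho))]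
  refine nonempty_prod_equiv_of_absorbing _ (meanZeroOp e selfLen) (meanZeroOp e id)
    (up 1) (down 1) (up 0) (down 0) ?_ ?_ (he.meanZeroOp_mul_self _ selfLen_le) ?_ ?_ ?_ ?_ ?_
  · intro f
    have := congrArg (fun u : S →L[𝕜] S => u f) he.avgOp_mul_meanZeroOp_id
    simpa using this
  · intro h hh
    have h0 : avgOp e id h = 0 := hh
    rw [he.meanZeroOp_id]
    simp [h0]
  · refine hext _ _ fun m o ho => ?_
    simp only [add_apply, mul_apply_eq_comp]
    rw [he.meanZeroOp_pos _ selfLen_le ho, hdown 1 m o ho, hdown 0 m o ho]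
    rcases Nat.even_or_odd' m with ⟨n, rfl | rfl⟩
    · rw [selfLen_two_mul, if_neg (by omega : ¬ ((2 * n) % 2 = 1 ∧ o < 2 ^ (2 * n / 2)))]
      have h1 : 2 * n / 2 = n := by omega
      rw [h1]
      by_cases hon : o < 2 ^ n
      · rw [if_pos hon, if_pos ⟨by omega, hon⟩, he.meanZeroOp_pos id hid hon,
          if_pos (show o < 2 ^ id n from hon), map_sub, hup 0 n o hon,
          hupmean id selfLen 0 n le_rfl (selfLen_two_mul n)]
        simp
      · rw [if_neg hon, if_neg (fun h => hon h.2)]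
        simp
    · rw [selfLen_two_mul_add_one,
        if_neg (by omega : ¬ ((2 * n + 1) % 2 = 0 ∧ o < 2 ^ ((2 * n + 1) / 2)))]
      have h1 : (2 * n + 1) / 2 = n := by omega
      rw [h1]
      by_cases hon : o < 2 ^ n
      · rw [if_pos (⟨by omega, hon⟩ : (2 * n + 1) % 2 = 1 ∧ o < 2 ^ n),
          he.meanZeroOp_pos _ selfLen_le hon]
        split_ifs
        · rw [map_sub, hup 1 n o hon,
            hupmean selfLen selfLen 1 n (selfLen_le n) (selfLen_two_mul_add_one n)]
          simp
        · simp
      · rw [if_neg (fun h => hon (hlt (selfLen_le n) h)), if_neg (fun h => hon h.2)]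
        simp
  all_goals
    refine hext _ _ fun n o ho => ?_
    simp only [mul_apply_eq_comp, one_apply_eq_self,
      zero_apply]
    rw [hup _ n o ho, hdown _ _ o (hlt (by omega) ho)]
  · have h1 : (2 * n + 1) / 2 = n := by omega
    rw [h1, if_pos ⟨by omega, ho⟩]
  · have h1 : (2 * n + 0) / 2 = n := by omega
    rw [h1, if_pos ⟨by omega, ho⟩]
  · rw [if_neg (by omega)]
  · rw [if_neg (by omega)]

/-- A space that contains `S` as a complemented subspace absorbs what `S` absorbs. -/
theorem IsFinSubsymmetric.nonempty_ker_prod_equiv {X : Type*} [NormedAddCommGroup X]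
    [NormedSpace 𝕜 X] (hSX : IsIsoToComplemented 𝕜 S X) :
    Nonempty ((LinearMap.ker (avgOp e id : S →ₗ[𝕜] S) × X) ≃L[𝕜] X) := by
  obtain ⟨Φ⟩ := he.nonempty_prod_ker_equiv
  obtain ⟨L, T, hTL⟩ := hSX
  have hTL' : ∀ f, T (L f) = f := fun f => by
    have := congrArg (fun u : S →L[𝕜] S => u f) hTL
    simpa using this
  set V := LinearMap.ker (avgOp e id : S →ₗ[𝕜] S)
  refine ⟨ContinuousLinearEquiv.equivOfInverse
    ((ContinuousLinearMap.id 𝕜 X - L.comp T).comp (ContinuousLinearMap.snd 𝕜 V X) +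
      (L.comp (Φ : (S × V) →L[𝕜] S)).comp ((T.comp (ContinuousLinearMap.snd 𝕜 V X)).prod
        (ContinuousLinearMap.fst 𝕜 V X)))
    (((ContinuousLinearMap.snd 𝕜 S V).comp ((Φ.symm : S →L[𝕜] S × V).comp T)).prod
      (ContinuousLinearMap.id 𝕜 X - L.comp T + L.comp
        ((ContinuousLinearMap.fst 𝕜 S V).comp ((Φ.symm : S →L[𝕜] S × V).comp T)))) ?_ ?_⟩
  · rintro ⟨h, x⟩
    refine Prod.ext ?_ ?_
    · simp [hTL']
    · simp [hTL']
  · intro y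
    simp [hTL']

end Absorb

/-! ### The basis on the mean-zero part times `X` -/

section Functionals

variable {𝕜 S : Type*} [RCLike 𝕜] [NormedAddCommGroup S] [NormedSpace 𝕜 S]
  {e : SchauderBasis 𝕜 S}

theorem mean_id (e : SchauderBasis 𝕜 S) (n : ℕ) :
    mean e id n = ((2 : 𝕜) ^ n)⁻¹ • ∑ j ∈ dyadicBlock n, e j := by
  have h : 2 ^ (n + 1) - 1 - (2 ^ n - 1) = 2 ^ n := by
    have := Nat.one_le_two_pow (n := n)
    rw [pow_succ]
    omega
  rw [mean, dyadicBlock, Finset.sum_Ico_eq_sum_range, h]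
  rfl

theorem coord_mean_id (e : SchauderBasis 𝕜 S) (i n : ℕ) :
    e.coord i (mean e id n) = if blk i = n then ((2 : 𝕜) ^ n)⁻¹ else 0 := by
  have h := coord_sum_smul e (dyadicBlock n) (fun _ => 1) i
  simp only [one_smul] at h
  rw [mean_id, map_smul, h]
  by_cases hi : blk i = n <;> simp [mem_dyadicBlock, hi]

theorem norm_two_pow_inv (n : ℕ) : ‖((2 : 𝕜) ^ n)⁻¹‖ = ((2 : ℝ) ^ n)⁻¹ := by
  rw [norm_inv, norm_pow, RCLike.norm_ofNat]

variable (he : IsFinSubsymmetric e)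
include he

theorem IsFinSubsymmetric.norm_mean_id (n : ℕ) : ‖mean e id n‖ = wt e n := by
  rw [mean_id, norm_smul, norm_two_pow_inv, he.norm_sum_basis, card_dyadicBlock, wt,
    inv_mul_eq_div]

theorem IsFinSubsymmetric.unitSum_two_pow_pos (n : ℕ) : 0 < unitSum e (2 ^ n) :=
  he.unitSum_pos Nat.one_le_two_pow

variable [CompleteSpace S]

theorem IsFinSubsymmetric.avgOp_id_basis (j : ℕ) : avgOp e id (e j) = mean e id (blk j) := by
  rw [he.avgOp_basis id (fun _ => le_rfl), if_pos (show off j < 2 ^ id (blk j) from off_lt j)]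

theorem IsFinSubsymmetric.avgOp_sum_dyadicBlock (n : ℕ) (c : ℕ → 𝕜) :
    avgOp e id (∑ j ∈ dyadicBlock n, c j • e j) = (∑ j ∈ dyadicBlock n, c j) • mean e id n := by
  rw [map_sum, Finset.sum_smul]
  refine Finset.sum_congr rfl fun j hj => ?_
  rw [map_smul, he.avgOp_id_basis, mem_dyadicBlock.1 hj]

/-- For at most `2^k` summands, `f ↦ ∑_{j ∈ A} |f_j|` is bounded by a multiple of `2^k / Λ_{2^k}`:
put the summands into the `k`-th block, make them positive, and average. -/
theorem IsFinSubsymmetric.wt_mul_sum_norm_le (k : ℕ) (A : Finset ℕ) (hA : A.card ≤ 2 ^ k)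
    (c : ℕ → 𝕜) : wt e k * ∑ j ∈ A, ‖c j‖ ≤ 4 * ‖∑ j ∈ A, c j • e j‖ := by
  classical
  set d : ℕ → 𝕜 := fun j => (‖c j‖ : 𝕜) / c j with hd
  have hdc : ∀ j, d j * c j = (‖c j‖ : 𝕜) := fun j => by
    by_cases h : c j = 0
    · simp [hd, h]
    · simp [hd, h]
  have h1 := he.norm_sum_mul_le A c d 1 zero_le_one (fun j _ => by
    simp only [hd, norm_div, RCLike.norm_ofReal, abs_norm]
    exact div_self_le_one _)
  set ψ : ℕ → ℕ := fun j => pos k (A.filter (· < j)).card with hψ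
  have hlt : ∀ j ∈ A, (A.filter (· < j)).card < 2 ^ k := fun j hj =>
    (Finset.card_lt_card
      (Finset.filter_ssubset (p := fun x => x < j).2 ⟨j, hj, lt_irrefl j⟩)).trans_le hA
  have hmono : StrictMonoOn ψ A := by
    intro i hi j hj hij
    have : (A.filter (· < i)).card < (A.filter (· < j)).card := by
      refine Finset.card_lt_card ⟨?_, fun h => ?_⟩
      · intro x hx
        have := Finset.mem_filter.1 hx
        exact Finset.mem_filter.2 ⟨this.1, this.2.trans hij⟩
      · have := (Finset.mem_filter.1 (h (Finset.mem_filter.2 ⟨hi, hij⟩))).2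
        exact lt_irrefl _ this
    simp only [hψ, pos]
    omega
  have h2 := he.spread A (fun j => d j * c j) ψ hmono
  have h3 := he.norm_avgOp_le id (fun _ => le_rfl) (∑ j ∈ A, (d j * c j) • e (ψ j))
  have h4 : avgOp e id (∑ j ∈ A, (d j * c j) • e (ψ j)) =
      ((∑ j ∈ A, ‖c j‖ : ℝ) : 𝕜) • mean e id k := by
    rw [map_sum, RCLike.ofReal_sum, Finset.sum_smul]
    refine Finset.sum_congr rfl fun j hj => ?_
    rw [map_smul, he.avgOp_id_basis, hdc, hψ]
    dsimp only
    rw [blk_pos (hlt j hj)]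
  rw [h4, norm_smul, RCLike.norm_ofReal, he.norm_mean_id, h2,
    abs_of_nonneg (Finset.sum_nonneg fun _ _ => norm_nonneg _)] at h3
  linarith

theorem IsFinSubsymmetric.sum_coord_dyadicBlock {h : S} (hh : avgOp e id h = 0) (n : ℕ) :
    ∑ j ∈ dyadicBlock n, e.coord j h = 0 := by
  have key : ∑ j ∈ dyadicBlock n, e.coord j =
      (2 : 𝕜) ^ n • (e.coord (pos n 0)).comp (avgOp e id) := by
    refine clm_ext e fun i => ?_
    rw [smul_apply, ContinuousLinearMap.comp_apply, he.avgOp_id_basis, coord_mean_id,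
      blk_pos (by positivity)]
    rw [sum_apply]
    simp only [coord_apply_basis]
    rw [Finset.sum_ite_eq']
    simp only [mem_dyadicBlock]
    by_cases hi : blk i = n
    · subst hi
      simp
    · simp [hi, Ne.symm hi]
  have := congrArg (fun u : StrongDual 𝕜 S => u h) key
  simpa [sum_apply, hh] using this

theorem IsFinSubsymmetric.norm_meanZeroOp_id_le (x : S) : ‖meanZeroOp e id x‖ ≤ 3 * ‖x‖ := by
  have h := he.norm_avgOp_le id (fun _ => le_rfl) x
  rw [he.meanZeroOp_id, sub_apply, one_apply_eq_self]
  refine (norm_sub_le _ _).trans ?_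
  linarith

end Functionals

/-- The quantitative information on a semi-normalized basis that is used below. -/
structure BasisBound {𝕜 X : Type*} [RCLike 𝕜] [NormedAddCommGroup X] [NormedSpace 𝕜 X]
    (B : SchauderBasis 𝕜 X) (K : ℝ) : Prop where
  one_le : 1 ≤ K
  norm_basis_le : ∀ n, ‖B n‖ ≤ K
  norm_coord_le_norm_smul : ∀ n x, ‖B.coord n x‖ ≤ K * ‖B.coord n x • B n‖
  norm_coord_le : ∀ n x, ‖B.coord n x‖ ≤ K * ‖x‖
  norm_proj_le : ∀ n x, ‖∑ i ∈ Finset.range n, B.coord i x • B i‖ ≤ K * ‖x‖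

theorem IsSemiNormalized.exists_basisBound {𝕜 X : Type*} [RCLike 𝕜] [NormedAddCommGroup X]
    [NormedSpace 𝕜 X] [CompleteSpace X] {B : SchauderBasis 𝕜 X} (hB : IsSemiNormalized B) :
    ∃ K, BasisBound B K := by
  obtain ⟨c, C, hc, h⟩ := hB
  obtain ⟨M, hM⟩ := SchauderBasis.exists_norm_proj_le B
  have hM0 : 0 ≤ M := (norm_nonneg _).trans (hM 0)
  have hC0 : 0 ≤ C := (norm_nonneg _).trans (h 0).2
  have hproj : ∀ n x, ‖∑ i ∈ Finset.range n, B.coord i x • B i‖ ≤ M * ‖x‖ := fun n x => by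
    have := (B.proj n).le_of_opNorm_le (hM n) x
    rwa [SchauderBasis.proj_apply] at this
  have h1 : ∀ n x, ‖B.coord n x‖ ≤ c⁻¹ * ‖B.coord n x • B n‖ := fun n x => by
    rw [norm_smul, inv_mul_eq_div, le_div_iff₀ hc]
    exact mul_le_mul_of_nonneg_left (h n).1 (norm_nonneg _)
  have h2 : ∀ n x, ‖B.coord n x • B n‖ ≤ 2 * M * ‖x‖ := fun n x => by
    have : B.coord n x • B n = ∑ i ∈ Finset.range (n + 1), B.coord i x • B i -
        ∑ i ∈ Finset.range n, B.coord i x • B i := by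
      rw [Finset.sum_range_succ]; abel
    rw [this]
    refine (norm_sub_le _ _).trans ?_
    linarith [hproj n x, hproj (n + 1) x]
  have hci : 0 < c⁻¹ := inv_pos.2 hc
  have hp : 0 ≤ c⁻¹ * (2 * M) := by positivity
  refine ⟨1 + C + c⁻¹ + c⁻¹ * (2 * M) + M, by linarith, fun n => ?_, fun n x => ?_, fun n x => ?_,
    fun n x => ?_⟩
  · exact (h n).2.trans (by linarith)
  · refine (h1 n x).trans (mul_le_mul_of_nonneg_right (by linarith) (norm_nonneg _))
  · calc _ ≤ c⁻¹ * (2 * M * ‖x‖) := (h1 n x).trans (by gcongr; exact h2 n x)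
      _ = c⁻¹ * (2 * M) * ‖x‖ := by ring
      _ ≤ _ := mul_le_mul_of_nonneg_right (by linarith) (norm_nonneg _)
  · exact (hproj n x).trans (mul_le_mul_of_nonneg_right (by linarith) (norm_nonneg _))

section Construction

variable {𝕜 S X : Type*} [RCLike 𝕜] [NormedAddCommGroup S] [NormedSpace 𝕜 S] [CompleteSpace S]
  [NormedAddCommGroup X] [NormedSpace 𝕜 X]

/-- The sequences in `S` with mean zero on each dyadic block. -/
abbrev MeanZero (e : SchauderBasis 𝕜 S) : Submodule 𝕜 S :=
  LinearMap.ker (avgOp e id : S →ₗ[𝕜] S)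

variable {e : SchauderBasis 𝕜 S} (he : IsFinSubsymmetric e) (B : SchauderBasis 𝕜 X)

/-- The vectors `y_j = (Q e_j, (Λ_s / s) x_n)`, for `j` in the `n`-th block, whose length is `s`,
and for `Q = 1 - P` with the averaging projection `P`. In the model where sequences `f` carry the
norm of `(Q f, ∑_n ((Λ_s / s) ∑_{j ∈ σ_n} f_j) x_n)`, these are the unit vectors. -/
def blockVec (j : ℕ) : MeanZero e × X :=
  (⟨meanZeroOp e id (e j), by
    have := congrArg (fun u : S →L[𝕜] S => u (e j)) he.avgOp_mul_meanZeroOp_id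
    simpa using this⟩, (wt e (blk j) : 𝕜) • B (blk j))

/-- The coordinate functionals `y_j^* (h, x) = h_j + x_n^*(x) / Λ_s` of the `y_j`. -/
def blockCoord (e : SchauderBasis 𝕜 S) (B : SchauderBasis 𝕜 X) (j : ℕ) :
    StrongDual 𝕜 (MeanZero e × X) :=
  (e.coord j).comp ((MeanZero e).subtypeL.comp (ContinuousLinearMap.fst 𝕜 _ X)) +
    ((unitSum e (2 ^ blk j) : 𝕜)⁻¹) •
      (B.coord (blk j)).comp (ContinuousLinearMap.snd 𝕜 (MeanZero e) X)

theorem blockCoord_apply (j : ℕ) (z : MeanZero e × X) : blockCoord e B j z =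
    e.coord j (z.1 : S) + (unitSum e (2 ^ blk j) : 𝕜)⁻¹ * B.coord (blk j) z.2 := by
  simp [blockCoord]

theorem fst_sum_blockVec (A : Finset ℕ) (c : ℕ → 𝕜) :
    ((∑ j ∈ A, c j • blockVec he B j).1 : S) = meanZeroOp e id (∑ j ∈ A, c j • e j) := by
  rw [Prod.fst_sum, map_sum, Submodule.coe_sum]
  refine Finset.sum_congr rfl fun j _ => ?_
  rw [map_smul]
  rfl

theorem snd_sum_blockVec (A : Finset ℕ) (c : ℕ → 𝕜) :
    (∑ j ∈ A, c j • blockVec he B j).2 = ∑ j ∈ A, (c j * wt e (blk j)) • B (blk j) := by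
  rw [Prod.snd_sum]
  refine Finset.sum_congr rfl fun j _ => ?_
  rw [mul_smul]
  rfl

theorem blockCoord_blockVec (i j : ℕ) :
    blockCoord e B i (blockVec he B j) = (Pi.single j (1 : 𝕜) : ℕ → 𝕜) i := by
  have hj : meanZeroOp e id (e j) = e j - mean e id (blk j) := by
    rw [he.meanZeroOp_id, sub_apply, one_apply_eq_self, he.avgOp_id_basis]
  rw [blockCoord_apply]
  simp only [blockVec]
  rw [hj, map_sub, coord_apply_basis, coord_mean_id, map_smul, coord_apply_basis, wt,
    Pi.single_apply]
  by_cases h : blk i = blk j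
  · rw [if_pos h, if_pos h, h]
    have : (unitSum e (2 ^ blk j) : 𝕜) ≠ 0 := by
      exact_mod_cast (he.unitSum_two_pow_pos _).ne'
    push_cast
    rw [smul_eq_mul]
    field_simp
    ring
  · rw [if_neg h, if_neg h]
    simp

include he in
theorem sum_dyadicBlock_fst (n : ℕ) (z : MeanZero e × X) :
    meanZeroOp e id (∑ j ∈ dyadicBlock n, blockCoord e B j z • e j) =
      ∑ j ∈ dyadicBlock n, e.coord j (z.1 : S) • e j := by
  have hz : avgOp e id (z.1 : S) = 0 := z.1.2
  have h1 : ∑ j ∈ dyadicBlock n, blockCoord e B j z • e j =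
      ∑ j ∈ dyadicBlock n, e.coord j (z.1 : S) • e j + ((unitSum e (2 ^ n) : 𝕜)⁻¹ *
        B.coord n z.2) • ∑ j ∈ dyadicBlock n, e j := by
    rw [Finset.smul_sum, ← Finset.sum_add_distrib]
    refine Finset.sum_congr rfl fun j hj => ?_
    rw [blockCoord_apply, add_smul, mem_dyadicBlock.1 hj]
  have h2 : ∑ j ∈ dyadicBlock n, e j = (2 : 𝕜) ^ n • mean e id n := by
    rw [mean_id, smul_smul, mul_inv_cancel₀ (pow_ne_zero _ two_ne_zero), one_smul]
  rw [h1, map_add, map_smul, h2, map_smul, he.meanZeroOp_mean id (fun _ => le_rfl), smul_zero,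
    smul_zero, add_zero, he.meanZeroOp_id, sub_apply, he.avgOp_sum_dyadicBlock,
    he.sum_coord_dyadicBlock hz, zero_smul, sub_zero, one_apply_eq_self]

include he in
theorem sum_dyadicBlock_snd (n : ℕ) (z : MeanZero e × X) :
    ∑ j ∈ dyadicBlock n, (blockCoord e B j z * wt e (blk j)) • B (blk j) =
      B.coord n z.2 • B n := by
  have hz : avgOp e id (z.1 : S) = 0 := z.1.2
  rw [Finset.sum_congr rfl (g := fun j => (e.coord j (z.1 : S) * wt e n) • B n +
    ((unitSum e (2 ^ n) : 𝕜)⁻¹ * B.coord n z.2 * wt e n) • B n)]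
  · rw [Finset.sum_add_distrib, ← Finset.sum_smul, ← Finset.sum_mul,
      he.sum_coord_dyadicBlock hz, zero_mul, zero_smul, zero_add, Finset.sum_const,
      card_dyadicBlock, ← Nat.cast_smul_eq_nsmul 𝕜, smul_smul]
    congr 1
    have : (unitSum e (2 ^ n) : 𝕜) ≠ 0 := by
      exact_mod_cast (he.unitSum_two_pow_pos _).ne'
    rw [wt]
    push_cast
    field_simp
  · intro j hj
    rw [blockCoord_apply, mem_dyadicBlock.1 hj, ← add_smul, ← add_mul]

/-- On whole blocks, the projections of the new basis are projections for `e` and for `B`. -/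
theorem sum_blocks_blockVec (N : Finset ℕ) (z : MeanZero e × X) :
    ((∑ n ∈ N, ∑ j ∈ dyadicBlock n, blockCoord e B j z • blockVec he B j).1 : S) =
        ∑ n ∈ N, ∑ j ∈ dyadicBlock n, e.coord j (z.1 : S) • e j ∧
      (∑ n ∈ N, ∑ j ∈ dyadicBlock n, blockCoord e B j z • blockVec he B j).2 =
        ∑ n ∈ N, B.coord n z.2 • B n := by
  constructor
  · rw [Prod.fst_sum, Submodule.coe_sum]
    refine Finset.sum_congr rfl fun n _ => ?_
    rw [fst_sum_blockVec, sum_dyadicBlock_fst he]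
  · rw [Prod.snd_sum]
    refine Finset.sum_congr rfl fun n _ => ?_
    rw [snd_sum_blockVec, sum_dyadicBlock_snd he]

variable {B} {K : ℝ} (hK : BasisBound B K)
include hK

theorem norm_sum_blockVec_le (A : Finset ℕ) (c : ℕ → 𝕜) {R₁ R₂ : ℝ}
    (h₁ : ‖∑ j ∈ A, c j • e j‖ ≤ R₁) (h₂ : ∑ j ∈ A, ‖c j‖ * wt e (blk j) ≤ R₂) :
    ‖∑ j ∈ A, c j • blockVec he B j‖ ≤ max (3 * R₁) (K * R₂) := by
  rw [Prod.norm_def]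
  refine max_le_max ?_ ?_
  · have h := he.norm_meanZeroOp_id_le (∑ j ∈ A, c j • e j)
    rw [← fst_sum_blockVec he B] at h
    exact h.trans (by linarith)
  · rw [snd_sum_blockVec]
    have hK0 : 0 ≤ K := zero_le_one.trans hK.one_le
    calc _ ≤ ∑ j ∈ A, ‖(c j * wt e (blk j)) • B (blk j)‖ := norm_sum_le _ _
      _ ≤ ∑ j ∈ A, K * (‖c j‖ * wt e (blk j)) := by
          refine Finset.sum_le_sum fun j _ => ?_
          rw [norm_smul, norm_mul, RCLike.norm_ofReal, abs_of_nonneg (wt_nonneg _), mul_comm]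
          have := wt_nonneg (e := e) (blk j)
          exact mul_le_mul_of_nonneg_right (hK.norm_basis_le _) (by positivity)
      _ ≤ _ := by
          rw [← Finset.mul_sum]
          exact mul_le_mul_of_nonneg_left h₂ hK0

/-- Projections onto at most `2^n` indices in the blocks from the `n`-th on are harmless. -/
theorem norm_sum_far_le (n : ℕ) (A : Finset ℕ) (hA : ∀ j ∈ A, n ≤ blk j) (hcard : A.card ≤ 2 ^ n)
    (z : MeanZero e × X) (s : ℝ) (hs : 0 ≤ s) (hsA : ∀ j ∈ A, ‖B.coord (blk j) z.2‖ ≤ s) :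
    ‖∑ j ∈ A, blockCoord e B j z • blockVec he B j‖ ≤
      (4 * K + 6) * (‖∑ j ∈ A, e.coord j (z.1 : S) • e j‖ + s) := by
  have hK1 := hK.one_le
  have hpos := he.unitSum_two_pow_pos
  set b : ℕ → 𝕜 := fun j => (unitSum e (2 ^ blk j) : 𝕜)⁻¹ * B.coord (blk j) z.2 with hb
  have hbn : ∀ j, ‖b j‖ = ‖B.coord (blk j) z.2‖ / unitSum e (2 ^ blk j) := fun j => by
    simp only [hb, norm_mul, norm_inv, RCLike.norm_ofReal, abs_of_pos (hpos _)]
    rw [inv_mul_eq_div]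
  set T := ‖∑ j ∈ A, e.coord j (z.1 : S) • e j‖ with hT
  have h₁ : ‖∑ j ∈ A, blockCoord e B j z • e j‖ ≤ T + 2 * s := by
    have : ∑ j ∈ A, blockCoord e B j z • e j =
        ∑ j ∈ A, e.coord j (z.1 : S) • e j + ∑ j ∈ A, b j • e j := by
      rw [← Finset.sum_add_distrib]
      refine Finset.sum_congr rfl fun j _ => ?_
      rw [blockCoord_apply, add_smul]
    rw [this]
    refine (norm_add_le _ _).trans (add_le_add le_rfl ?_)
    refine (he.norm_sum_le A b (s / unitSum e (2 ^ n)) (div_nonneg hs (hpos n).le) ?_).trans ?_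
    · intro j hj
      rw [hbn]
      exact div_le_div₀ hs (hsA j hj) (hpos n)
        (he.unitSum_mono (Nat.pow_le_pow_right (by norm_num) (hA j hj)))
    · have h := he.unitSum_mono hcard
      have h0 : 0 ≤ s / unitSum e (2 ^ n) := div_nonneg hs (hpos n).le
      calc 2 * (s / unitSum e (2 ^ n)) * unitSum e A.card ≤
            2 * (s / unitSum e (2 ^ n)) * unitSum e (2 ^ n) := by gcongr
        _ = 2 * s := by have := (hpos n).ne'; field_simp
  have h₂ : ∑ j ∈ A, ‖blockCoord e B j z‖ * wt e (blk j) ≤ 4 * T + s := by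
    have h3 : ∑ j ∈ A, ‖blockCoord e B j z‖ * wt e (blk j) ≤
        ∑ j ∈ A, (wt e n * ‖e.coord j (z.1 : S)‖ + s / 2 ^ n) := by
      refine Finset.sum_le_sum fun j hj => ?_
      have hw := wt_nonneg (e := e) (blk j)
      have hwn : wt e (blk j) ≤ wt e n := he.wt_antitone (hA j hj)
      have hbw : ‖b j‖ * wt e (blk j) ≤ s / 2 ^ n := by
        have h5 : ‖b j‖ * wt e (blk j) = ‖B.coord (blk j) z.2‖ / 2 ^ blk j := by
          rw [hbn, wt]
          have := (hpos (blk j)).ne'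
          field_simp
        rw [h5]
        exact div_le_div₀ hs (hsA j hj) (by positivity)
          (pow_le_pow_right₀ (by norm_num) (hA j hj))
      calc ‖blockCoord e B j z‖ * wt e (blk j) ≤
            (‖e.coord j (z.1 : S)‖ + ‖b j‖) * wt e (blk j) := by
            rw [blockCoord_apply]
            gcongr
            exact norm_add_le _ _
        _ = wt e (blk j) * ‖e.coord j (z.1 : S)‖ + ‖b j‖ * wt e (blk j) := by ring
        _ ≤ _ := by gcongr
    refine h3.trans ?_
    rw [Finset.sum_add_distrib, ← Finset.mul_sum, Finset.sum_const, nsmul_eq_mul]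
    refine add_le_add (he.wt_mul_sum_norm_le n A hcard _) ?_
    have h6 : (A.card : ℝ) ≤ 2 ^ n := by exact_mod_cast hcard
    calc (A.card : ℝ) * (s / 2 ^ n) ≤ 2 ^ n * (s / 2 ^ n) := by gcongr
      _ = s := by field_simp
  refine (norm_sum_blockVec_le he hK A _ h₁ h₂).trans (max_le ?_ ?_)
  · have : 0 ≤ T := norm_nonneg _
    nlinarith
  · have : 0 ≤ T := norm_nonneg _
    nlinarith

omit he hK [CompleteSpace S] in
theorem tendsto_blk : Filter.Tendsto blk Filter.atTop Filter.atTop := by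
  refine Filter.tendsto_atTop.2 fun n => ?_
  filter_upwards [Filter.eventually_ge_atTop (2 ^ n - 1)] with j hj
  exact le_blk_iff.2 hj

theorem tendsto_sum_blockVec (z : MeanZero e × X) :
    Filter.Tendsto (fun N => ∑ j ∈ Finset.range N, blockCoord e B j z • blockVec he B j)
      Filter.atTop (nhds z) := by
  have hS := SchauderBasis.tendsto_proj e (z.1 : S)
  have hX := SchauderBasis.tendsto_proj B z.2
  simp only [SchauderBasis.proj_apply] at hS hX
  have hpow : Filter.Tendsto (fun n : ℕ => 2 ^ n - 1) Filter.atTop Filter.atTop := by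
    refine Filter.tendsto_atTop_mono (fun n => ?_) Filter.tendsto_id
    have := Nat.lt_two_pow_self (n := n)
    simp only [id]
    omega
  have hS1 := hS.comp hpow
  have hS2 := hS1.comp (Filter.tendsto_add_atTop_nat 1)
  have hX2 := hX.comp (Filter.tendsto_add_atTop_nat 1)
  have hfull : Filter.Tendsto (fun n => ∑ j ∈ Finset.range (2 ^ n - 1),
      blockCoord e B j z • blockVec he B j) Filter.atTop (nhds z) := by
    refine (Prod.tendsto_iff _ _).2 ⟨tendsto_subtype_rng.2 ?_, ?_⟩
    · refine hS1.congr fun n => ?_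
      rw [sum_range_two_pow, (sum_blocks_blockVec he B _ z).1]
      simp only [Function.comp]
      rw [sum_range_two_pow]
    · refine hX.congr fun n => ?_
      rw [sum_range_two_pow, (sum_blocks_blockVec he B _ z).2]
  have hzero : Filter.Tendsto (fun n => (4 * K + 6) * (‖∑ j ∈ dyadicBlock n,
      e.coord j (z.1 : S) • e j‖ + K * ‖B.coord n z.2 • B n‖)) Filter.atTop (nhds 0) := by
    have h1 : Filter.Tendsto (fun n => ∑ j ∈ dyadicBlock n, e.coord j (z.1 : S) • e j)
        Filter.atTop (nhds 0) := by
      have := hS2.sub hS1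
      rw [sub_self] at this
      refine this.congr fun n => ?_
      simp only [Function.comp]
      rw [sum_range_two_pow, sum_range_two_pow, Finset.sum_range_succ]
      abel
    have h2 : Filter.Tendsto (fun n => B.coord n z.2 • B n) Filter.atTop (nhds 0) := by
      have := hX2.sub hX
      rw [sub_self] at this
      refine this.congr fun n => ?_
      simp only [Function.comp]
      rw [Finset.sum_range_succ]
      abel
    have := (h1.norm.add (h2.norm.const_mul K)).const_mul (4 * K + 6)
    simpa using this
  have hrest : Filter.Tendsto (fun N => ∑ j ∈ Finset.Ico (2 ^ blk N - 1) N,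
      blockCoord e B j z • blockVec he B j) Filter.atTop (nhds 0) := by
    refine squeeze_zero_norm (fun N => ?_) (hzero.comp tendsto_blk)
    have hsub : Finset.Ico (2 ^ blk N - 1) N ⊆ dyadicBlock (blk N) := by
      intro j hj
      rw [Finset.mem_Ico] at hj
      rw [mem_dyadicBlock]
      exact le_antisymm (blk_mono hj.2.le) (le_blk_iff.2 hj.1)
    have hK0 : 0 ≤ K := zero_le_one.trans hK.one_le
    refine (norm_sum_far_le he hK (blk N) _ (fun j hj => (mem_dyadicBlock.1 (hsub hj)).ge)
      ((Finset.card_le_card hsub).trans (card_dyadicBlock _).le) z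
      (K * ‖B.coord (blk N) z.2 • B (blk N)‖) (by positivity) ?_).trans ?_
    · intro j hj
      rw [mem_dyadicBlock.1 (hsub hj)]
      exact hK.norm_coord_le_norm_smul _ _
    · simp only [Function.comp]
      gcongr
      exact he.norm_sum_le_of_subset hsub _
  have := (hfull.comp tendsto_blk).add hrest
  rw [add_zero] at this
  refine this.congr fun N => ?_
  simp only [Function.comp]
  refine Finset.sum_range_add_sum_Ico _ ?_
  exact le_blk_iff.1 le_rfl

/-- The vectors `y_j` as a Schauder basis. -/
def blockBasis : SchauderBasis 𝕜 (MeanZero e × X) where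
  basis := blockVec he B
  coord := blockCoord e B
  ortho i j := by rw [blockCoord_blockVec he B]; simp [Pi.single_apply]
  expansion z := by
    rw [HasSum, SummationFilter.conditional_filter_eq_map_range, Filter.tendsto_map'_iff]
    exact tendsto_sum_blockVec he hK z

end Construction

/-! ### A criterion for almost greedy bases -/

section Criterion

variable {𝕜 Z W : Type*} [RCLike 𝕜] [NormedAddCommGroup Z] [NormedSpace 𝕜 Z]
  [NormedAddCommGroup W] [NormedSpace 𝕜 W]

/-- Two-sided democracy estimates for coefficients that are only bounded above or below, with the
fundamental function `Λ`, and boundedness of the greedy projections. -/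
structure GreedyBounds (b : SchauderBasis 𝕜 Z) (Λ : ℕ → ℝ) (C : ℝ) : Prop where
  nonneg : 0 ≤ C
  upper : ∀ (A : Finset ℕ) (c : ℕ → 𝕜) (t : ℝ), 0 ≤ t → (∀ j ∈ A, ‖c j‖ ≤ t) →
    ‖∑ j ∈ A, c j • b j‖ ≤ C * (t * Λ A.card)
  lower : ∀ (z : Z) (A : Finset ℕ) (t : ℝ), 0 ≤ t → (∀ j ∈ A, t ≤ ‖b.coord j z‖) →
    t * Λ A.card ≤ C * ‖z‖
  quasi : ∀ (z : Z) (G : Finset ℕ),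
    (∀ j, j ∉ G → ∀ k ∈ G, ‖b.coord j z‖ ≤ ‖b.coord k z‖) →
    ‖∑ j ∈ G, b.coord j z • b j‖ ≤ C * ‖z‖

/-- If `G = F \ A` and `g = f - S_A f`, then `f - S_F f = g + S_{A \ F} f - S_G g`, where `G` is a
greedy set of `g`, and where `S_{A \ F} f` has coefficients smaller than those of `g` on `G`. -/
theorem GreedyBounds.isAlmostGreedy {b : SchauderBasis 𝕜 Z} {Λ : ℕ → ℝ} {C : ℝ}
    (h : GreedyBounds b Λ C) (hΛ : Monotone Λ) (hΛ1 : 0 < Λ 1) : IsAlmostGreedy b := by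
  classical
  have hC := h.nonneg
  refine ⟨⟨Λ 1 / (C + 1), C * Λ 1, by positivity, fun j => ⟨?_, ?_⟩⟩, 1 + C * C + C, ?_⟩
  · have := h.lower (b j) {j} 1 zero_le_one (fun i hi => by
      rw [Finset.mem_singleton.1 hi, coord_apply_basis]; simp)
    rw [div_le_iff₀ (by linarith)]
    simp only [Finset.card_singleton, one_mul] at this
    nlinarith [norm_nonneg (b j)]
  · have := h.upper {j} (fun _ => 1) 1 zero_le_one (by simp)
    simpa using this
  intro f A F hcard hF
  simp only [GeneralSchauderBasis.proj_apply]
  set g := f - ∑ j ∈ A, b.coord j f • b j with hg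
  have hgc : ∀ j, b.coord j g = if j ∈ A then 0 else b.coord j f := fun j => by
    rw [hg, map_sub, coord_sum_smul b A (fun i => b.coord i f)]
    split_ifs <;> simp
  set G := F \ A with hG
  set H := A \ F with hH
  have hHG : H.card ≤ G.card := by
    have h1 := Finset.card_sdiff_add_card_inter A F
    have h2 := Finset.card_sdiff_add_card_inter F A
    rw [Finset.inter_comm] at h2
    rw [hG, hH]
    omega
  have hgG : ∀ j ∈ G, b.coord j g = b.coord j f := fun j hj => by
    rw [hgc, if_neg (Finset.mem_sdiff.1 hj).2]
  have hq : ‖∑ j ∈ G, b.coord j g • b j‖ ≤ C * ‖g‖ := by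
    refine h.quasi g G fun j hj k hk => ?_
    rw [hgG k hk, hgc]
    split_ifs with hjA
    · simp
    · exact hF j (fun hjF => hj (Finset.mem_sdiff.2 ⟨hjF, hjA⟩)) k (Finset.mem_sdiff.1 hk).1
  have hHn : ‖∑ j ∈ H, b.coord j f • b j‖ ≤ C * C * ‖g‖ := by
    rcases G.eq_empty_or_nonempty with hGe | hGne
    · have : H = ∅ := by
        rw [← Finset.card_eq_zero]
        rw [hGe, Finset.card_empty] at hHG
        omega
      rw [this, Finset.sum_empty, norm_zero]
      positivity
    · obtain ⟨k, hk, hmin⟩ := Finset.exists_min_image G (fun j => ‖b.coord j f‖) hGne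
      have h1 := h.upper H (fun j => b.coord j f) ‖b.coord k f‖ (norm_nonneg _)
        (fun j hj => hF j (Finset.mem_sdiff.1 hj).2 k (Finset.mem_sdiff.1 hk).1)
      have h2 := h.lower g G ‖b.coord k f‖ (norm_nonneg _)
        (fun j hj => by rw [hgG j hj]; exact hmin j hj)
      have h3 : ‖b.coord k f‖ * Λ H.card ≤ ‖b.coord k f‖ * Λ G.card := by
        gcongr
        exact hΛ hHG
      calc _ ≤ C * (‖b.coord k f‖ * Λ H.card) := h1
        _ ≤ C * (C * ‖g‖) := mul_le_mul_of_nonneg_left (h3.trans h2) hC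
        _ = _ := by ring
  have hdec : f - ∑ j ∈ F, b.coord j f • b j =
      g + ∑ j ∈ H, b.coord j f • b j - ∑ j ∈ G, b.coord j g • b j := by
    rw [Finset.sum_congr rfl (fun j hj => by rw [hgG j hj] :
      ∀ j ∈ G, b.coord j g • b j = b.coord j f • b j), hg]
    have h1 := Finset.sum_inter_add_sum_sdiff A F (fun j => b.coord j f • b j)
    have h2 := Finset.sum_inter_add_sum_sdiff F A (fun j => b.coord j f • b j)
    rw [Finset.inter_comm] at h2
    rw [← h1, ← h2]
    abel
  rw [hdec]
  refine (norm_sub_le _ _).trans ?_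
  have := norm_add_le g (∑ j ∈ H, b.coord j f • b j)
  linarith

theorem GreedyBounds.fundFun_dominated {b : SchauderBasis 𝕜 Z} {Λ : ℕ → ℝ} {C : ℝ}
    (h : GreedyBounds b Λ C) (hΛ : Monotone Λ) (hΛ1 : 0 < Λ 1) : Dominated (fundFun b) Λ := by
  have hC := h.nonneg
  refine ⟨C + 1, by linarith, fun m hm => csSup_le ⟨0, ∅, by simp, by simp⟩ ?_⟩
  rintro _ ⟨A, hA, rfl⟩
  have h1 := h.upper A (fun _ => 1) 1 zero_le_one (by simp)
  simp only [one_smul, one_mul] at h1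
  have h2 : Λ A.card ≤ Λ m := hΛ hA
  have h3 : 0 < Λ m := hΛ1.trans_le (hΛ hm)
  calc _ ≤ C * Λ A.card := h1
    _ ≤ C * Λ m := by gcongr
    _ ≤ _ := by linarith

theorem GreedyBounds.dominated_fundFun {b : SchauderBasis 𝕜 Z} {Λ : ℕ → ℝ} {C : ℝ}
    (h : GreedyBounds b Λ C) (hΛ : Monotone Λ) (hΛ1 : 0 < Λ 1) : Dominated Λ (fundFun b) := by
  have hC := h.nonneg
  have hbdd := bddAbove_fundFun b (h.isAlmostGreedy hΛ hΛ1).1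
  refine ⟨C + 1, by linarith, fun m _ => ?_⟩
  have h1 := h.lower (∑ j ∈ Finset.range m, b j) (Finset.range m) 1 zero_le_one (fun j hj => by
    have := coord_sum_smul b (Finset.range m) (fun _ => 1) j
    simp only [one_smul] at this
    rw [this, if_pos hj]
    simp)
  rw [one_mul, Finset.card_range] at h1
  have h2 : ‖∑ j ∈ Finset.range m, b j‖ ≤ fundFun b m :=
    le_csSup (hbdd m) ⟨Finset.range m, by simp, rfl⟩
  nlinarith [norm_nonneg (∑ j ∈ Finset.range m, b j)]

/-- The image of a Schauder basis under an isomorphism. -/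
def mapBasis (b : SchauderBasis 𝕜 Z) (Θ : Z ≃L[𝕜] W) : SchauderBasis 𝕜 W where
  basis j := Θ (b j)
  coord j := (b.coord j).comp (Θ.symm : W →L[𝕜] Z)
  ortho i j := by simpa using! b.ortho i j
  expansion x := by
    have := (b.expansion (Θ.symm x)).map (Θ : Z →+ W) Θ.continuous
    simpa [Function.comp_def] using! this

theorem coord_mapBasis (b : SchauderBasis 𝕜 Z) (Θ : Z ≃L[𝕜] W) (j : ℕ) (x : W) :
    (mapBasis b Θ).coord j x = b.coord j (Θ.symm x) := rfl

theorem sum_mapBasis (b : SchauderBasis 𝕜 Z) (Θ : Z ≃L[𝕜] W) (A : Finset ℕ) (c : ℕ → 𝕜) :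
    ∑ j ∈ A, c j • mapBasis b Θ j = Θ (∑ j ∈ A, c j • b j) := by
  rw [map_sum]
  exact Finset.sum_congr rfl fun j _ => (map_smul Θ _ _).symm

theorem exists_norm_equiv_le (Θ : Z ≃L[𝕜] W) :
    ∃ M : ℝ, 1 ≤ M ∧ (∀ z, ‖Θ z‖ ≤ M * ‖z‖) ∧ ∀ w, ‖Θ.symm w‖ ≤ M * ‖w‖ := by
  refine ⟨1 + ‖(Θ : Z →L[𝕜] W)‖ + ‖(Θ.symm : W →L[𝕜] Z)‖, ?_, fun z => ?_, fun w => ?_⟩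
  · linarith [norm_nonneg (Θ : Z →L[𝕜] W), norm_nonneg (Θ.symm : W →L[𝕜] Z)]
  · refine ((Θ : Z →L[𝕜] W).le_opNorm z).trans (mul_le_mul_of_nonneg_right ?_ (norm_nonneg _))
    linarith [norm_nonneg (Θ.symm : W →L[𝕜] Z)]
  · refine ((Θ.symm : W →L[𝕜] Z).le_opNorm w).trans (mul_le_mul_of_nonneg_right ?_ (norm_nonneg _))
    linarith [norm_nonneg (Θ : Z →L[𝕜] W)]

theorem GreedyBounds.exists_map {b : SchauderBasis 𝕜 Z} {Λ : ℕ → ℝ} {C : ℝ}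
    (h : GreedyBounds b Λ C) (hΛ : ∀ m, 0 ≤ Λ m) (Θ : Z ≃L[𝕜] W) :
    ∃ C', GreedyBounds (mapBasis b Θ) Λ C' := by
  obtain ⟨M, hM1, hM, hM'⟩ := exists_norm_equiv_le Θ
  have hC := h.nonneg
  have hMM : M ≤ M * M := by nlinarith
  refine ⟨M * M * C, by positivity, fun A c t ht hc => ?_, fun w A t ht hw => ?_,
    fun w G hG => ?_⟩
  · rw [sum_mapBasis]
    have h0 : 0 ≤ t * Λ A.card := mul_nonneg ht (hΛ _)
    calc _ ≤ M * ‖∑ j ∈ A, c j • b j‖ := hM _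
      _ ≤ M * (C * (t * Λ A.card)) := by gcongr; exact h.upper A c t ht hc
      _ ≤ M * M * (C * (t * Λ A.card)) := by gcongr
      _ = _ := by ring
  · calc _ ≤ C * ‖Θ.symm w‖ := h.lower _ A t ht hw
      _ ≤ C * (M * ‖w‖) := by gcongr; exact hM' w
      _ ≤ C * (M * M * ‖w‖) := by gcongr
      _ = _ := by ring
  · simp only [coord_mapBasis]
    rw [sum_mapBasis]
    calc _ ≤ M * ‖∑ j ∈ G, b.coord j (Θ.symm w) • b j‖ := hM _
      _ ≤ M * (C * ‖Θ.symm w‖) := by gcongr; exact h.quasi _ G hG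
      _ ≤ M * (C * (M * ‖w‖)) := by gcongr; exact hM' w
      _ = _ := by ring

end Criterion

/-! ### Greedy bounds and conditionality of the block basis -/

section BlockBasis

variable {𝕜 S X : Type*} [RCLike 𝕜] [NormedAddCommGroup S] [NormedSpace 𝕜 S] [CompleteSpace S]
  [NormedAddCommGroup X] [NormedSpace 𝕜 X] {e : SchauderBasis 𝕜 S} (he : IsFinSubsymmetric e)
  {B : SchauderBasis 𝕜 X} {K : ℝ} (hK : BasisBound B K)

omit [CompleteSpace S] in
include he in
theorem IsFinSubsymmetric.unitSum_two_mul_le (m : ℕ) :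
    unitSum e (2 * m) ≤ 2 * unitSum e m := by
  have := he.unitSum_add_le m m
  rw [← two_mul] at this
  linarith

theorem blockBasis_upper (r : ℕ)
    (hr : ∀ n : ℕ, 2 * unitSum e (2 ^ n) ≤ unitSum e (2 ^ (n + r)))
    (A : Finset ℕ) (c : ℕ → 𝕜) (t : ℝ) (ht : 0 ≤ t) (hc : ∀ j ∈ A, ‖c j‖ ≤ t) :
    ‖∑ j ∈ A, c j • blockBasis he hK j‖ ≤
      (6 + K * (2 * r + 3)) * (t * unitSum e A.card) := by
  have hK1 := hK.one_le
  have hΛ : 0 ≤ unitSum e A.card := unitSum_nonneg _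
  have h2 : ∑ j ∈ A, ‖c j‖ * wt e (blk j) ≤ t * ((2 * r + 3) * unitSum e A.card) := by
    refine (Finset.sum_le_sum fun j hj =>
      mul_le_mul_of_nonneg_right (hc j hj) (wt_nonneg _)).trans ?_
    rw [← Finset.mul_sum]
    exact mul_le_mul_of_nonneg_left (he.sum_wt_le r hr A) ht
  refine (norm_sum_blockVec_le he hK A c (he.norm_sum_le A c t ht hc) h2).trans (max_le ?_ ?_)
  · have : 0 ≤ K * (2 * r + 3) * (t * unitSum e A.card) := by positivity
    linarith
  · have : 0 ≤ t * unitSum e A.card := by positivity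
    linarith

/-- Discarding the blocks much shorter than `|A|` costs at most half of `A`; on the remaining blocks
the `X`-part of `z` contributes at most a multiple of `‖z‖ / Λ_{|A|}` to each coefficient. -/
theorem blockBasis_lower (z : MeanZero e × X) (A : Finset ℕ) (t : ℝ) (ht : 0 ≤ t)
    (hA : ∀ j ∈ A, t ≤ ‖(blockBasis he hK).coord j z‖) :
    t * unitSum e A.card ≤ (4 + 32 * K) * ‖z‖ := by
  classical
  have hK1 := hK.one_le
  have hpos := he.unitSum_two_pow_pos
  rcases A.eq_empty_or_nonempty with rfl | hne
  · simp only [Finset.card_empty, unitSum, Finset.range_zero, Finset.sum_empty, norm_zero,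
      mul_zero]
    positivity
  set l := Nat.log 2 A.card with hl
  set n := l - 1 with hn
  have hl1 : 2 ^ l ≤ A.card := Nat.pow_log_le_self 2 hne.card_pos.ne'
  have hl2 : A.card < 2 ^ (l + 1) := Nat.lt_pow_succ_log_self (by norm_num) _
  set A' := A.filter (fun j => ¬ j < 2 ^ n - 1) with hA'
  have hcard : A.card ≤ 2 * A'.card := by
    have h1 : (A.filter (fun j => j < 2 ^ n - 1)).card + A'.card = A.card :=
      Finset.card_filter_add_card_filter_not (s := A) (fun j => j < 2 ^ n - 1)
    have h2 : (A.filter (fun j => j < 2 ^ n - 1)).card ≤ 2 ^ n - 1 := by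
      calc _ ≤ (Finset.range (2 ^ n - 1)).card :=
            Finset.card_le_card fun j hj => Finset.mem_range.2 (Finset.mem_filter.1 hj).2
        _ = _ := Finset.card_range _
    have h3 : 2 * (2 ^ n - 1) ≤ A.card := by
      rcases Nat.eq_zero_or_pos l with h0 | h0
      · simp [hn, h0]
      · have : 2 * 2 ^ n = 2 ^ l := by rw [← pow_succ', hn, Nat.sub_add_cancel h0]
        omega
    omega
  have hblk : ∀ j ∈ A', n ≤ blk j := fun j hj =>
    le_blk_iff.2 (not_lt.1 (Finset.mem_filter.1 hj).2)
  have hΛn : unitSum e A'.card ≤ 4 * unitSum e (2 ^ n) := by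
    have h1 : A'.card ≤ 2 * (2 * 2 ^ n) := by
      calc A'.card ≤ A.card := Finset.card_filter_le _ _
        _ ≤ 2 ^ (l + 1) := hl2.le
        _ ≤ 2 ^ (n + 1 + 1) := Nat.pow_le_pow_right (by norm_num) (by omega)
        _ = _ := by ring
    have h2 := he.unitSum_two_mul_le (2 * 2 ^ n)
    have h3 := he.unitSum_two_mul_le (2 ^ n)
    have h4 := he.unitSum_mono h1
    linarith
  set b : ℕ → 𝕜 := fun j => (unitSum e (2 ^ blk j) : 𝕜)⁻¹ * B.coord (blk j) z.2 with hb
  have hz2 : ‖z.2‖ ≤ ‖z‖ := _root_.norm_snd_le z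
  have hz1 : ‖(z.1 : S)‖ ≤ ‖z‖ := _root_.norm_fst_le z
  have hbn : ‖∑ j ∈ A', b j • e j‖ ≤ 8 * K * ‖z‖ := by
    have h0 : 0 ≤ K * ‖z‖ / unitSum e (2 ^ n) := div_nonneg (by positivity) (hpos n).le
    refine (he.norm_sum_le A' b (K * ‖z‖ / unitSum e (2 ^ n)) h0 fun j hj => ?_).trans ?_
    · simp only [hb, norm_mul, norm_inv, RCLike.norm_ofReal, abs_of_pos (hpos _)]
      rw [inv_mul_eq_div]
      refine div_le_div₀ (by positivity) ?_ (hpos n)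
        (he.unitSum_mono (Nat.pow_le_pow_right (by norm_num) (hblk j hj)))
      exact (hK.norm_coord_le _ _).trans (by gcongr)
    · calc _ ≤ 2 * (K * ‖z‖ / unitSum e (2 ^ n)) * (4 * unitSum e (2 ^ n)) := by gcongr
        _ = _ := by have := (hpos n).ne'; field_simp; ring
  have h1 := he.le_norm_sum A' (fun j => blockCoord e B j z) t ht
    (fun j hj => hA j (Finset.filter_subset _ _ hj))
  have h2 : ‖∑ j ∈ A', blockCoord e B j z • e j‖ ≤ ‖z‖ + 8 * K * ‖z‖ := by
    have : ∑ j ∈ A', blockCoord e B j z • e j =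
        ∑ j ∈ A', e.coord j (z.1 : S) • e j + ∑ j ∈ A', b j • e j := by
      rw [← Finset.sum_add_distrib]
      refine Finset.sum_congr rfl fun j _ => ?_
      rw [blockCoord_apply, add_smul]
    rw [this]
    exact (norm_add_le _ _).trans
      (add_le_add ((he.norm_sum_coord_le _ _).trans hz1) hbn)
  have h3 : unitSum e A.card ≤ 2 * unitSum e A'.card :=
    (he.unitSum_mono hcard).trans (he.unitSum_two_mul_le _)
  calc t * unitSum e A.card ≤ t * (2 * unitSum e A'.card) := by gcongr
    _ = 2 * (t * unitSum e A'.card) := by ring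
    _ ≤ 2 * (2 * (‖z‖ + 8 * K * ‖z‖)) := by linarith
    _ = _ := by ring

/-- A greedy set `G` is compared with the union `D` of the blocks up to length about `|G|`. The
projection onto `D` is a partial sum in `S` and in `X`, the coefficients on `D \ G` are small,
and `G \ D` lies in blocks longer than `|G|`. -/
theorem blockBasis_quasi (r : ℕ)
    (hr : ∀ n : ℕ, 2 * unitSum e (2 ^ n) ≤ unitSum e (2 ^ (n + r)))
    (z : MeanZero e × X) (G : Finset ℕ)
    (hG : ∀ j, j ∉ G → ∀ k ∈ G,
      ‖(blockBasis he hK).coord j z‖ ≤ ‖(blockBasis he hK).coord k z‖) :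
    ‖∑ j ∈ G, (blockBasis he hK).coord j z • blockBasis he hK j‖ ≤
      (K + 2 * ((6 + K * (2 * r + 3)) * (4 + 32 * K)) + (4 * K + 6) * (1 + K)) * ‖z‖ := by
  classical
  have hK1 := hK.one_le
  have hz2 : ‖z.2‖ ≤ ‖z‖ := _root_.norm_snd_le z
  have hz1 : ‖(z.1 : S)‖ ≤ ‖z‖ := _root_.norm_fst_le z
  rcases G.eq_empty_or_nonempty with rfl | hne
  · rw [Finset.sum_empty, norm_zero]
    positivity
  set n := Nat.log 2 G.card + 1 with hn
  have hn1 : 2 ^ n ≤ 2 * G.card := by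
    have := Nat.pow_log_le_self 2 hne.card_pos.ne'
    rw [hn, pow_succ]
    omega
  have hn2 : G.card < 2 ^ n := Nat.lt_pow_succ_log_self (by norm_num) _
  set D := Finset.range (2 ^ n - 1) with hD
  set F : ℕ → MeanZero e × X :=
    fun j => (blockBasis he hK).coord j z • blockBasis he hK j with hF
  have hdec : ∑ j ∈ G, F j = ∑ j ∈ D, F j - ∑ j ∈ D \ G, F j + ∑ j ∈ G \ D, F j := by
    have h1 := Finset.sum_inter_add_sum_sdiff D G F
    have h2 := Finset.sum_inter_add_sum_sdiff G D F
    rw [Finset.inter_comm] at h2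
    rw [← h1, ← h2]
    abel
  have hfull : ‖∑ j ∈ D, F j‖ ≤ K * ‖z‖ := by
    have h := sum_blocks_blockVec he B (Finset.range n) z
    have hsum : ∑ j ∈ D, F j = ∑ i ∈ Finset.range n, ∑ j ∈ dyadicBlock i,
        blockCoord e B j z • blockVec he B j := sum_range_two_pow F n
    rw [hsum, Prod.norm_def]
    refine max_le ?_ ?_
    · change ‖((∑ i ∈ Finset.range n, ∑ j ∈ dyadicBlock i,
        blockCoord e B j z • blockVec he B j).1 : S)‖ ≤ _
      rw [h.1, ← sum_range_two_pow]
      have := he.norm_sum_coord_le (Finset.range (2 ^ n - 1)) (z.1 : S)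
      nlinarith [norm_nonneg z]
    · rw [h.2]
      exact (hK.norm_proj_le _ _).trans (by gcongr)
  have hsmall : ‖∑ j ∈ D \ G, F j‖ ≤
      2 * ((6 + K * (2 * r + 3)) * (4 + 32 * K)) * ‖z‖ := by
    obtain ⟨k, hk, hmin⟩ := Finset.exists_min_image G
      (fun j => ‖(blockBasis he hK).coord j z‖) hne
    set t := ‖(blockBasis he hK).coord k z‖ with ht
    have ht0 : 0 ≤ t := norm_nonneg _
    have h1 := blockBasis_upper he hK r hr (D \ G)
      (fun j => (blockBasis he hK).coord j z) t ht0
      (fun j hj => hG j (Finset.mem_sdiff.1 hj).2 k hk)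
    have h2 := blockBasis_lower he hK z G t ht0 hmin
    have h3 : unitSum e (D \ G).card ≤ 2 * unitSum e G.card := by
      refine (he.unitSum_mono ?_).trans (he.unitSum_two_mul_le _)
      calc (D \ G).card ≤ D.card := Finset.card_le_card Finset.sdiff_subset
        _ = 2 ^ n - 1 := Finset.card_range _
        _ ≤ _ := by omega
    calc _ ≤ (6 + K * (2 * r + 3)) * (t * unitSum e (D \ G).card) := h1
      _ ≤ (6 + K * (2 * r + 3)) * (t * (2 * unitSum e G.card)) := by gcongr
      _ = 2 * (6 + K * (2 * r + 3)) * (t * unitSum e G.card) := by ring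
      _ ≤ 2 * (6 + K * (2 * r + 3)) * ((4 + 32 * K) * ‖z‖) := by gcongr
      _ = _ := by ring
  have hfar : ‖∑ j ∈ G \ D, F j‖ ≤ (4 * K + 6) * (1 + K) * ‖z‖ := by
    have h1 := norm_sum_far_le he hK n (G \ D)
      (fun j hj => le_blk_iff.2 (by simpa [hD] using (Finset.mem_sdiff.1 hj).2))
      ((Finset.card_le_card Finset.sdiff_subset).trans hn2.le) z (K * ‖z‖) (by positivity)
      (fun j _ => (hK.norm_coord_le _ _).trans (by gcongr))
    have h2 := (he.norm_sum_coord_le (G \ D) (z.1 : S)).trans hz1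
    calc _ ≤ _ := h1
      _ ≤ (4 * K + 6) * (‖z‖ + K * ‖z‖) := by gcongr
      _ = _ := by ring
  rw [hdec]
  refine (norm_add_le _ _).trans ?_
  have := norm_sub_le (∑ j ∈ D, F j) (∑ j ∈ D \ G, F j)
  linarith

theorem exists_greedyBounds_blockBasis (r : ℕ)
    (hr : ∀ n : ℕ, 2 * unitSum e (2 ^ n) ≤ unitSum e (2 ^ (n + r))) :
    ∃ C, GreedyBounds (blockBasis he hK) (unitSum e) C := by
  have hK1 := hK.one_le
  set C₁ := 6 + K * (2 * r + 3)
  set C₂ := 4 + 32 * K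
  set C₃ := K + 2 * (C₁ * C₂) + (4 * K + 6) * (1 + K)
  have h1 : 0 ≤ C₁ := by positivity
  have h2 : 0 ≤ C₂ := by positivity
  have h3 : 0 ≤ C₃ := by positivity
  refine ⟨C₁ + C₂ + C₃, by positivity, fun A c t ht hc => ?_, fun z A t ht hA => ?_,
    fun z G hG => ?_⟩
  · have h0 : 0 ≤ t * unitSum e A.card := mul_nonneg ht (unitSum_nonneg _)
    exact (blockBasis_upper he hK r hr A c t ht hc).trans
      (mul_le_mul_of_nonneg_right (by linarith) h0)
  · exact (blockBasis_lower he hK z A t ht hA).trans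
      (mul_le_mul_of_nonneg_right (by linarith) (norm_nonneg _))
  · exact (blockBasis_quasi he hK r hr z G hG).trans
      (mul_le_mul_of_nonneg_right (by linarith) (norm_nonneg _))

omit [CompleteSpace S] in
theorem condConst_nonneg (b : SchauderBasis 𝕜 S) (m : ℕ) : 0 ≤ condConst b m :=
  le_csSup (bddAbove_condQuotients b m) ⟨∅, 0, by simp, by simp⟩

/-- A vector `x` in the span of the first `r` vectors of `B` corresponds to `(0, x)`, which is
supported on the first `r` blocks, that is, on the first `2^r - 1` indices. -/
theorem exists_condConst_le {W : Type*} [NormedAddCommGroup W] [NormedSpace 𝕜 W]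
    (Θ : (MeanZero e × X) ≃L[𝕜] W) :
    ∃ M : ℝ, 0 ≤ M ∧ ∀ r m : ℕ, 2 ^ r - 1 ≤ m →
      condConst B r ≤ M * condConst (mapBasis (blockBasis he hK) Θ) m := by
  classical
  obtain ⟨M, hM1, hM, hM'⟩ := exists_norm_equiv_le Θ
  refine ⟨M * M, by positivity, fun r m hrm => ?_⟩
  refine csSup_le ⟨0, ∅, 0, by simp, by simp⟩ ?_
  rintro _ ⟨A, f, hf, rfl⟩
  have hnn := condConst_nonneg (mapBasis (blockBasis he hK) Θ) m
  rcases eq_or_ne f 0 with rfl | hf0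
  · rw [norm_zero, div_zero]
    positivity
  set z : MeanZero e × X := (0, f) with hz
  set A' := A.biUnion dyadicBlock with hA'
  have hdisj : (A : Set ℕ).PairwiseDisjoint dyadicBlock := by
    intro i _ k _ hik
    refine Finset.disjoint_left.2 fun j hi hk => hik ?_
    rw [← mem_dyadicBlock.1 hi, ← mem_dyadicBlock.1 hk]
  have hproj : ∑ j ∈ A', blockCoord e B j z • blockVec he B j =
      (0, ∑ n ∈ A, B.coord n f • B n) := by
    rw [hA', Finset.sum_biUnion hdisj]
    have h := sum_blocks_blockVec he B A z
    refine Prod.ext (Subtype.ext ?_) h.2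
    rw [h.1]
    simp [hz]
  have hmem : ‖GeneralSchauderBasis.proj (mapBasis (blockBasis he hK) Θ) A' (Θ z)‖ / ‖Θ z‖ ≤
      condConst (mapBasis (blockBasis he hK) Θ) m := by
    refine le_csSup (bddAbove_condQuotients _ m) ⟨A', Θ z, fun j hj => ?_, rfl⟩
    rw [coord_mapBasis, Θ.symm_apply_apply]
    change blockCoord e B j z = 0
    rw [blockCoord_apply, hf (blk j) (le_blk_iff.2 (hrm.trans hj))]
    simp [hz]
  have hp : GeneralSchauderBasis.proj (mapBasis (blockBasis he hK) Θ) A' (Θ z) =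
      Θ (0, ∑ n ∈ A, B.coord n f • B n) := by
    rw [GeneralSchauderBasis.proj_apply]
    simp only [coord_mapBasis, Θ.symm_apply_apply]
    rw [sum_mapBasis, ← hproj]
    rfl
  rw [hp] at hmem
  have hf1 : 0 < ‖f‖ := norm_pos_iff.2 hf0
  have hzn : ‖z‖ = ‖f‖ := by simp [hz, Prod.norm_def]
  have hΘz : 0 < ‖Θ z‖ := by
    rw [norm_pos_iff]
    intro h
    rw [map_eq_zero_iff Θ Θ.injective] at h
    rw [h, norm_zero] at hzn
    linarith
  have hnum : ‖∑ n ∈ A, B.coord n f • B n‖ ≤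
      M * ‖Θ ((0 : MeanZero e), ∑ n ∈ A, B.coord n f • B n)‖ := by
    have := hM' (Θ ((0 : MeanZero e), ∑ n ∈ A, B.coord n f • B n))
    rw [Θ.symm_apply_apply, Prod.norm_def] at this
    exact (le_max_right _ _).trans this
  have hden := hM z
  rw [hzn] at hden
  rw [GeneralSchauderBasis.proj_apply, div_le_iff₀ hf1]
  rw [div_le_iff₀ hΘz] at hmem
  calc _ ≤ _ := hnum
    _ ≤ M * (condConst (mapBasis (blockBasis he hK) Θ) m * ‖Θ z‖) := by gcongr
    _ ≤ M * (condConst (mapBasis (blockBasis he hK) Θ) m * (M * ‖f‖)) := by gcongr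
    _ = _ := by ring

end BlockBasis

/-! ### The logarithmic estimate -/

theorem log_le_two_mul_natLog (m : ℕ) (hm : 1 ≤ m) :
    Real.log m ≤ 2 * (Nat.log 2 (m + 1) : ℕ) := by
  set r := Nat.log 2 (m + 1) with hr
  have hr1 : 1 ≤ r := Nat.le_log_of_pow_le (by norm_num) (by omega)
  have hlt : m + 1 < 2 ^ (r + 1) := Nat.lt_pow_succ_log_self (by norm_num) _
  have hm0 : (0 : ℝ) < m := by exact_mod_cast hm
  have h1 : Real.log m ≤ Real.log ((2 : ℝ) ^ (r + 1)) := by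
    refine Real.log_le_log hm0 ?_
    have : m ≤ 2 ^ (r + 1) := by omega
    exact_mod_cast this
  rw [Real.log_pow] at h1
  have h2 := Real.log_two_lt_d9
  have hr1' : (1 : ℝ) ≤ r := by exact_mod_cast hr1
  push_cast at h1
  nlinarith

/-- If the conditionality constants of two bases are related by `L_r ≲ L'_{2^r - 1}`, then lower
bounds for `L` by a doubling function pass to `L'` with a logarithm. -/
theorem dominated_log {δ : ℝ → ℝ} (hδ_mono : MonotoneOn δ (Set.Ici 0)) (hδ : IsDoubling δ)
    {α β : ℕ → ℝ} (hα : Dominated (fun m => δ m) α) (hβ : ∀ m, 0 ≤ β m) {M : ℝ} (hM : 0 ≤ M)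
    (h : ∀ r m : ℕ, 2 ^ r - 1 ≤ m → α r ≤ M * β m) : Dominated (fun m => δ (Real.log m)) β := by
  obtain ⟨C, hC, hdbl⟩ := hδ
  obtain ⟨C', hC', hαδ⟩ := hα
  refine ⟨C * (C' * M) + 1, by positivity, fun m hm => ?_⟩
  -- `m + 1` instead of `m` makes `r ≥ 1` also for `m = 1`
  set r := Nat.log 2 (m + 1) with hr
  have hr1 : 1 ≤ r := Nat.le_log_of_pow_le (by norm_num) (by omega)
  have hpow : 2 ^ r ≤ m + 1 := Nat.pow_log_le_self 2 (by omega)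
  have hm1 : (1 : ℝ) ≤ m := by exact_mod_cast hm
  have hlog := log_le_two_mul_natLog m hm
  rw [← hr] at hlog
  calc δ (Real.log m) ≤ δ (2 * (r : ℝ)) :=
        hδ_mono (Real.log_nonneg hm1) (show (0 : ℝ) ≤ 2 * (r : ℝ) by positivity) hlog
    _ ≤ C * δ r := hdbl r (by positivity)
    _ ≤ C * (C' * α r) := by gcongr; exact hαδ r hr1
    _ ≤ C * (C' * (M * β m)) := by gcongr; exact h r m (by omega)
    _ = C * (C' * M) * β m := by ring
    _ ≤ (C * (C' * M) + 1) * β m := by nlinarith [hβ m]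

end Greedy

end

theorem theorem4p1 {𝕜 X S : Type*} [RCLike 𝕜]
    [NormedAddCommGroup X] [NormedSpace 𝕜 X] [CompleteSpace X]
    [NormedAddCommGroup S] [NormedSpace 𝕜 S] [CompleteSpace S]
    (B : SchauderBasis 𝕜 X) (hB : Greedy.IsSemiNormalized B)
    (e : SchauderBasis 𝕜 S)
    (hS : Greedy.IsEllOne e ∨ (Greedy.IsOneSubsymmetric e ∧ Greedy.HasNontrivialType S))
    (hSX : Greedy.IsIsoToComplemented 𝕜 S X)
    (δ : ℝ → ℝ) (hδ_nonneg : ∀ t : ℝ, 0 ≤ t → 0 ≤ δ t)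
    (hδ_mono : MonotoneOn δ (Set.Ici 0)) (hδ_doubling : Greedy.IsDoubling δ)
    (hL : Greedy.Dominated (fun m => δ m) (Greedy.condConst B)) :
    ∃ Bκ : SchauderBasis 𝕜 X,
      Greedy.IsAlmostGreedy Bκ ∧
      (Greedy.Dominated (Greedy.fundFun Bκ) (fun n => ‖∑ j ∈ Finset.range n, e j‖) ∧
        Greedy.Dominated (fun n => ‖∑ j ∈ Finset.range n, e j‖) (Greedy.fundFun Bκ)) ∧
      Greedy.Dominated (fun m => δ (Real.log m)) (Greedy.condConst Bκ) := by
  have he : Greedy.IsFinSubsymmetric e :=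
    hS.elim (fun h => h.isFinSubsymmetric) (fun h => h.1.isFinSubsymmetric)
  obtain ⟨r, hr⟩ : ∃ r : ℕ, ∀ n : ℕ,
      2 * Greedy.unitSum e (2 ^ n) ≤ Greedy.unitSum e (2 ^ (n + r)) :=
    hS.elim (fun h => h.exists_two_mul_unitSum_le) (fun h => he.exists_two_mul_unitSum_le h.2)
  obtain ⟨K, hK⟩ := hB.exists_basisBound
  obtain ⟨Θ⟩ := he.nonempty_ker_prod_equiv hSX
  obtain ⟨C, hC⟩ := Greedy.exists_greedyBounds_blockBasis he hK r hr
  obtain ⟨C', hC'⟩ := hC.exists_map Greedy.unitSum_nonneg Θ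
  obtain ⟨M, hM, hcond⟩ := Greedy.exists_condConst_le he hK Θ
  have hmono : Monotone (Greedy.unitSum e) := fun _ _ h => he.unitSum_mono h
  have hpos : 0 < Greedy.unitSum e 1 := he.unitSum_pos le_rfl
  exact ⟨Greedy.mapBasis (Greedy.blockBasis he hK) Θ, hC'.isAlmostGreedy hmono hpos,
    ⟨hC'.fundFun_dominated hmono hpos, hC'.dominated_fundFun hmono hpos⟩,
    Greedy.dominated_log hδ_mono hδ_doubling hL (Greedy.condConst_nonneg _) hM hcond⟩
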